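/- **Conventions.** For a real or complex Hilbert space $E$ and $\kappa>0$ let $\hat E$ be the projective limit of the finite-dimensional subspaces $V\subseteq E$ under the orthogonal projections (the algebraic dual of the topological dual of $E$), with projections $l_V:\hat E\to V$, and let $\nu_{\kappa}$ be the probability measure on $\hat E$ whose image under each $l_V$ is the Gaussian measure with density proportional to $e^{-\kappa\|x\|^2}$. A function $f:E\to\mathbb C$ is called integrable over $(\hat E,\nu_\kappa)$ if the cylinder functions $f\circ l_V$ are eventually integrable and converge in $L^1(\hat E,\nu_\kappa)$, along the directed set of finite-dimensional subspaces $V$ (over the scalar field of $E$), to some $\hat f$; then $\int_{\hat E} f\,d\nu_\kappa:=\int\hat f\,d\nu_\kappa$. (If $\dim E<\infty$ this is ordinary integrability.) For a complex separable Hilbert space $L$ with inner product $\{\cdot,\cdot\}$ (antilinear in the first argument) put $g=\mathrm{Re}\{\cdot,\cdot\}$, $\omega=\tfrac12\mathrm{Im}\{\cdot,\cdot\}$, $K_\xi(\phi)=\exp(\tfrac12\{\xi,\phi\})$ for $\xi,\phi\in L$. Let $\mathcal H_L=\mathrm H^2(\hat L,\nu_{1/2})$ be the space of square-integrable holomorphic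 functions, viewed as functions on $L$, and $\overline L$ the conjugate Hilbert space, with $\iota:\mathcal H_L\to\mathcal H_{\overline L}$ complex conjugation. If $R\subseteq L$ is a closed real Lagrangian subspace, the amplitude of $\psi$ is $\rho_R(\psi)=\int_{\hat R}\psi|_R\,d\nu_{1/4}$ (norm from $g$ on $R$), considered on the dense subspace $\mathcal H_L^\circ\subseteq\mathcal H_L$ of finite linear combinations of coherent states $K_\xi$. **Gluing data.** Let $L_{\Sigma_1},L_\Sigma$ be complex separable Hilbert spaces and $L_{\partial M}=L_{\Sigma_1}\oplus L_\Sigma\oplus\overline{L_{\Sigma}}$ (the last summand belonging to $\overline{\Sigma'}$, $\Sigma'$ a copy of $\Sigma$). Let $L_M,L_{M_1}$ be real vector spaces and $r_M:L_M\to L_{\partial M}$, $r_{M_1}:L_{M_1}\to L_{\Sigma_1}$ real-linear maps whose images are closed Lagrangian subspaces; write $\rho_M,\rho_{M_1}$ for the amplitudes of these images and $\mathcal H^\circ_{\partial M},\mathcal H^\circ_{\Sigma_1}$ for their domains. Let $L_{M_1}\to L_M$ be an injective linear map whose image is the set of those $x\in L_M$ for which the components of $r_M(x)$ in $L_\Sigma$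 and in $\overline{L_\Sigma}$ coincide, and whose composition with $r_M$ and the projection to $L_{\Sigma_1}$ is $r_{M_1}$. **Theorem.** Suppose that the integrability condition holds: the function $\xi\mapsto\rho_M(K_0\otimes K_\xi\otimes\iota(K_\xi))$ on $L_\Sigma$ is integrable over $(\hat L_\Sigma,\nu_\Sigma)$, $\nu_\Sigma=\nu_{1/2}$, with nonzero integral. Then the gluing axiom holds in coherent-state form: there is $c\in\mathbb C\setminus\{0\}$ such that for every $\psi\in\mathcal H^\circ_{\Sigma_1}$ one has $\psi\otimes K_\xi\otimes\iota(K_\xi)\in\mathcal H^\circ_{\partial M}$ for all $\xi\in L_\Sigma$, the function $\xi\mapsto\rho_M(\psi\otimes K_\xi\otimes\iota(K_\xi))$ is integrable over $(\hat L_\Sigma,\nu_\Sigma)$, and $$\rho_{M_1}(\psi)\cdot c=\int_{\hat L_\Sigma}\rho_M\bigl(\psi\otimes K_\xi\otimes\iota(K_\xi)\bigr)\,d\nu_\Sigma(\xi).$$ Moreover, any such $c$ (the gluing anomaly factor) equals $$\int_{\hat L_\Sigma}\rho_M\bigl(K_0\otimes K_\xi\otimes\iota(K_\xi)\bigr)\,d\nu_\Sigma(\xi).$$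 -/

import Mathlib

open MeasureTheory ProbabilityTheory Filter Topology ComplexConjugate
open scoped NNReal ENNReal InnerProductSpace

noncomputable section
namespace HoloQuant

/-! ### White noise

Auxiliary facts, used only to show that the canonical Gaussian measure below exists. -/

section Existence
variable {ι : Type*}

/-- The law of a family of independent standard real Gaussians. -/
abbrev prodGauss (ι : Type*) : Measure (ι → ℝ) := Measure.infinitePi fun _ : ι => gaussianReal 0 1

theorem memLp_coord (i : ι) : MemLp (fun ω : ι → ℝ => ω i) 2 (prodGauss ι) := by
  have h : MemLp (id : ℝ → ℝ) 2 (gaussianReal 0 1) := IsGaussian.memLp_two_id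
  exact h.comp_measurePreserving (measurePreserving_eval_infinitePi (fun _ : ι => gaussianReal 0 1) i)

/-- The coordinate functions, as elements of `L²`. -/
def coord (i : ι) : Lp ℝ 2 (prodGauss ι) := (memLp_coord i).toLp _

theorem integral_coord (i : ι) (f : ℝ → ℝ) (hf : Continuous f) :
    ∫ ω : ι → ℝ, f (ω i) ∂(prodGauss ι) = ∫ x, f x ∂(gaussianReal 0 1) := by
  rw [← (measurePreserving_eval_infinitePi (fun _ : ι => gaussianReal 0 1) i).map_eq,
    integral_map (measurable_pi_apply i).aemeasurable hf.aestronglyMeasurable]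

theorem orthonormal_coord : Orthonormal ℝ (coord : ι → Lp ℝ 2 (prodGauss ι)) := by
  classical
  rw [orthonormal_iff_ite]
  intro i j
  have e1 : ⟪coord i, coord j⟫_ℝ = ∫ ω : ι → ℝ, ω j * ω i ∂(prodGauss ι) := by
    rw [L2.inner_def]
    apply integral_congr_ae
    filter_upwards [(memLp_coord i).coeFn_toLp, (memLp_coord j).coeFn_toLp] with ω h1 h2
    simp only [coord, h1, h2]
    simp
  rw [e1]
  split_ifs with h
  · subst h
    rw [integral_coord i (fun x => x * x) (by fun_prop)]
    have hv := variance_id_gaussianReal (μ := 0) (v := 1)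
    rw [variance_eq_integral (by fun_prop)] at hv
    simpa [integral_id_gaussianReal, ← sq] using hv
  · have hind : IndepFun (fun ω : ι → ℝ => ω j) (fun ω => ω i) (prodGauss ι) :=
      (iIndepFun_infinitePi (P := fun _ : ι => gaussianReal 0 1) (X := fun _ ω ↦ ω)
        (by fun_prop)).indepFun (Ne.symm h)
    rw [hind.integral_fun_mul_eq_mul_integral (measurable_pi_apply j).aestronglyMeasurable
      (measurable_pi_apply i).aestronglyMeasurable,
      integral_coord i (fun x => x) continuous_id]
    simp

theorem charFun_finite (s : Finset ι) (a : ι → ℝ) :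
    ∫ ω : ι → ℝ, Complex.exp ((∑ i ∈ s, a i * ω i : ℝ) * Complex.I) ∂(prodGauss ι)
      = Complex.exp (-((∑ i ∈ s, a i ^ 2 : ℝ) : ℂ) / 2) := by
  have hm := Measure.infinitePi_map_restrict (μ := fun _ : ι => gaussianReal 0 1) (I := s)
  have e : ∫ ω : ι → ℝ, Complex.exp ((∑ i ∈ s, a i * ω i : ℝ) * Complex.I) ∂(prodGauss ι)
     = ∫ x : s → ℝ, Complex.exp ((∑ i : s, a i * x i : ℝ) * Complex.I) ∂(Measure.pi fun _ : s => gaussianReal 0 1) := by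
    rw [← hm, integral_map (by fun_prop) (Continuous.aestronglyMeasurable (by fun_prop))]
    congr 1; ext ω
    rw [← Finset.sum_coe_sort]; rfl
  rw [e]
  have e2 : (fun x : s → ℝ => Complex.exp ((∑ i : s, a i * x i : ℝ) * Complex.I)) =
      fun x => ∏ i : s, Complex.exp ((a i : ℂ) * (x i : ℂ) * Complex.I) := by
    ext x; rw [← Complex.exp_sum]; push_cast; rw [Finset.sum_mul]
  rw [e2, integral_fintype_prod_eq_prod (f := fun (i : s) (x : ℝ) => Complex.exp ((a i : ℂ) * (x : ℂ) * Complex.I))]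
  have : ∀ t : ℝ, ∫ x : ℝ, Complex.exp ((t : ℂ) * (x : ℂ) * Complex.I) ∂(gaussianReal 0 1) = Complex.exp (-(t:ℂ)^2 / 2) := by
    intro t
    rw [← charFun_apply_real, charFun_gaussianReal]
    simp [neg_div]
  simp_rw [this]
  rw [← Complex.exp_sum, Finset.sum_coe_sort s (fun i => -(a i : ℂ)^2/2)]
  congr 1
  push_cast
  rw [← Finset.sum_div, Finset.sum_neg_distrib]

theorem norm_charFun_sub_le {Ω : Type*} [MeasurableSpace Ω] (P : Measure Ω) [IsProbabilityMeasure P] (f g : Lp ℝ 2 P) :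
    ‖(∫ ω, Complex.exp ((f ω : ℝ) * Complex.I) ∂P) - ∫ ω, Complex.exp ((g ω : ℝ) * Complex.I) ∂P‖ ≤ ‖f - g‖ := by
  have hi : ∀ f : Lp ℝ 2 P, Integrable (fun ω => Complex.exp ((f ω : ℝ) * Complex.I)) P := by
    intro f
    have hf := (Lp.aestronglyMeasurable f).aemeasurable
    refine Integrable.of_bound (C := 1) (by fun_prop) (Eventually.of_forall fun ω => ?_)
    rw [Complex.norm_exp_ofReal_mul_I]
  rw [← integral_sub (hi f) (hi g)]
  have h1 : Integrable (fun ω => ‖(f - g : Lp ℝ 2 P) ω‖) P :=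
    ((Lp.memLp (f - g)).integrable (by norm_num)).norm
  calc _ ≤ ∫ ω, ‖(f - g : Lp ℝ 2 P) ω‖ ∂P := by
        refine norm_integral_le_of_norm_le h1 ?_
        filter_upwards [Lp.coeFn_sub f g] with ω hω
        rw [hω, Pi.sub_apply]
        have : Complex.exp ((f ω : ℝ) * Complex.I) - Complex.exp ((g ω : ℝ) * Complex.I) =
          Complex.exp ((g ω : ℝ) * Complex.I) * (Complex.exp (Complex.I * ((f ω - g ω : ℝ))) - 1) := by
          rw [mul_sub, ← Complex.exp_add, mul_one]; congr 2; push_cast; ring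
        rw [this, norm_mul, Complex.norm_exp_ofReal_mul_I, one_mul]
        exact Real.norm_exp_I_mul_ofReal_sub_one_le
    _ = (eLpNorm (f - g : Lp ℝ 2 P) 1 P).toReal := by
        rw [integral_norm_eq_lintegral_enorm (Lp.aestronglyMeasurable _), eLpNorm_one_eq_lintegral_enorm]
    _ ≤ (eLpNorm (f - g : Lp ℝ 2 P) 2 P).toReal := by
        refine ENNReal.toReal_mono (Lp.eLpNorm_ne_top _) ?_
        exact eLpNorm_le_eLpNorm_of_exponent_le (by norm_num) (Lp.aestronglyMeasurable _)
    _ = ‖f - g‖ := (Lp.norm_def _).symm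

/-- The isometry of `ℓ²` into `L²` that sends the unit vectors to the coordinate functions. -/
def white (ι : Type*) : lp (fun _ : ι => ℝ) 2 →ₗᵢ[ℝ] Lp ℝ 2 (prodGauss ι) :=
  (orthonormal_coord (ι := ι)).orthogonalFamily.linearIsometry

theorem charFun_white (x : lp (fun _ : ι => ℝ) 2) :
    ∫ ω, Complex.exp ((white ι x ω : ℝ) * Complex.I) ∂(prodGauss ι) = Complex.exp (-((‖x‖ ^ 2 : ℝ) : ℂ) / 2) := by
  have hs := (orthonormal_coord (ι := ι)).orthogonalFamily.hasSum_linearIsometry x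
  have hfin : ∀ s : Finset ι, ∫ ω, Complex.exp (((∑ i ∈ s, LinearIsometry.toSpanSingleton ℝ _ ((orthonormal_coord (ι := ι)).1 i) (x i) : Lp ℝ 2 (prodGauss ι)) ω : ℝ) * Complex.I) ∂(prodGauss ι) = Complex.exp (-((∑ i ∈ s, x i ^ 2 : ℝ) : ℂ) / 2) := by
    intro s
    rw [← charFun_finite s (fun i => x i)]
    apply integral_congr_ae
    have : (((∑ i ∈ s, LinearIsometry.toSpanSingleton ℝ _ ((orthonormal_coord (ι := ι)).1 i) (x i) : Lp ℝ 2 (prodGauss ι)) : (ι → ℝ) → ℝ)) =ᵐ[prodGauss ι] fun ω => ∑ i ∈ s, x i * ω i := by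
      classical
      induction s using Finset.induction_on with
      | empty =>
        simp only [Finset.sum_empty]
        exact Lp.coeFn_zero ℝ 2 (prodGauss ι)
      | insert a s ha ih =>
        rw [Finset.sum_insert ha]
        filter_upwards [ih, Lp.coeFn_add (LinearIsometry.toSpanSingleton ℝ _ ((orthonormal_coord (ι := ι)).1 a) (x a)) (∑ i ∈ s, LinearIsometry.toSpanSingleton ℝ _ ((orthonormal_coord (ι := ι)).1 i) (x i)), Lp.coeFn_smul (x a) (coord a), (memLp_coord a).coeFn_toLp] with ω h1 h2 h3 h4
        rw [h2, Pi.add_apply, h1, Finset.sum_insert ha]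
        congr 1
        change (x a • coord a : Lp ℝ 2 (prodGauss ι)) ω = _
        rw [h3, Pi.smul_apply, smul_eq_mul]
        congr 1
    filter_upwards [this] with ω hω
    rw [hω]
  have l1 : Tendsto (fun s : Finset ι => ∫ ω, Complex.exp (((∑ i ∈ s, LinearIsometry.toSpanSingleton ℝ _ ((orthonormal_coord (ι := ι)).1 i) (x i) : Lp ℝ 2 (prodGauss ι)) ω : ℝ) * Complex.I) ∂(prodGauss ι)) atTop (𝓝 (∫ ω, Complex.exp ((white ι x ω : ℝ) * Complex.I) ∂(prodGauss ι))) := by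
    rw [tendsto_iff_norm_sub_tendsto_zero]
    have : Tendsto (fun s : Finset ι => ‖(∑ i ∈ s, LinearIsometry.toSpanSingleton ℝ _ ((orthonormal_coord (ι := ι)).1 i) (x i) : Lp ℝ 2 (prodGauss ι)) - white ι x‖) atTop (𝓝 0) :=
      tendsto_iff_norm_sub_tendsto_zero.1 hs
    exact squeeze_zero (fun _ => norm_nonneg _) (fun s => norm_charFun_sub_le _ _ _) this
  have l2 : Tendsto (fun s : Finset ι => Complex.exp (-((∑ i ∈ s, x i ^ 2 : ℝ) : ℂ) / 2)) atTop (𝓝 (Complex.exp (-((‖x‖ ^ 2 : ℝ) : ℂ) / 2))) := by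
    have h := lp.hasSum_norm (p := 2) (by norm_num) x
    have h' : HasSum (fun i => x i ^ 2) (‖x‖ ^ 2) := by
      simpa using h
    have hc : Continuous fun r : ℝ => Complex.exp (-(r : ℂ) / 2) := by fun_prop
    exact (hc.tendsto _).comp h'
  refine tendsto_nhds_unique l1 ?_
  simpa only [hfin] using l2

end Existence

/-! ### The Gaussian measure on the algebraic dual -/

section Dual
variable (𝕜 : Type*) [RCLike 𝕜] (E : Type*) [NormedAddCommGroup E] [InnerProductSpace 𝕜 E]

/-- The extension `Ê` of a real or complex Hilbert space `E`: the projective limit of the finite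
dimensional subspaces of `E` under the orthogonal projections, that is, the algebraic dual of the
topological dual of `E`. As the topological dual of `E` is antilinearly identified with `E`, its
elements are the antilinear functionals on `E`, without any continuity. The value `φ ξ` is the
extension to `φ ∈ Ê` of the inner product `⟪ξ, φ⟫`. -/
abbrev AlgDual : Type _ := E →ₛₗ[starRingEnd 𝕜] 𝕜

/-- The `σ`-algebra generated by the evaluations. -/
instance : MeasurableSpace (AlgDual 𝕜 E) :=
  MeasurableSpace.comap (fun (φ : AlgDual 𝕜 E) (v : E) => φ v) MeasurableSpace.pi

variable {E} in
/-- `ν` is the canonical Gaussian measure on `Ê` of the real inner product `c * re ⟪⬝, ⬝⟫`: its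
projection to each finite dimensional subspace of `E` has the density
`const * exp (-c * ‖x‖ ^ 2)`. In terms of coordinates: the real coordinates with respect to vectors
that are orthonormal for `re ⟪⬝, ⬝⟫` are independent centered Gaussians of variance `1 / (2 * c)`.
These conditions determine `ν` on the `σ`-algebra that the evaluations generate. -/
def IsCanonicalGaussian (c : ℝ≥0) (ν : Measure (AlgDual 𝕜 E)) : Prop :=
  ∀ (n : ℕ) (e : Fin n → E), (∀ i j, RCLike.re ⟪e i, e j⟫_𝕜 = if i = j then (1 : ℝ) else 0) →
    ν.map (fun φ i => RCLike.re (φ (e i))) = Measure.pi fun _ : Fin n => gaussianReal 0 (2 * c)⁻¹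

theorem exists_white (F : Type*) [NormedAddCommGroup F] [InnerProductSpace ℝ F] :
    ∃ (ι : Set (UniformSpace.Completion F)) (U : F →ₗᵢ[ℝ] Lp ℝ 2 (prodGauss ι)), ∀ v,
      ∫ ω, Complex.exp ((U v ω : ℝ) * Complex.I) ∂(prodGauss ι)
        = Complex.exp (-((‖v‖ ^ 2 : ℝ) : ℂ) / 2) := by
  obtain ⟨w, b, -⟩ := exists_hilbertBasis ℝ (UniformSpace.Completion F)
  refine ⟨w, (white w).comp (b.repr.toLinearIsometry.comp UniformSpace.Completion.toComplₗᵢ),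
    fun v => ?_⟩
  rw [← LinearIsometry.norm_map
    (b.repr.toLinearIsometry.comp (UniformSpace.Completion.toComplₗᵢ (𝕜 := ℝ))) v]
  exact charFun_white _

/-- The antilinear functional with prescribed values on a Hamel basis. -/
def dualOfBasis {β : Type*} (B : Module.Basis β 𝕜 E) (z : β → 𝕜) : AlgDual 𝕜 E where
  toFun v := conj (B.constr 𝕜 (fun b => conj (z b)) v)
  map_add' := by simp
  map_smul' := by simp

theorem dualOfBasis_apply {β : Type*} (B : Module.Basis β 𝕜 E) (z : β → 𝕜) (v : E) :
    dualOfBasis 𝕜 E B z v = ∑ b ∈ (B.repr v).support, conj (B.repr v b) * z b := by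
  simp [dualOfBasis, Module.Basis.constr_apply, Finsupp.sum]

theorem exists_isCanonicalGaussian (c : ℝ≥0) :
    ∃ ν : Measure (AlgDual 𝕜 E), IsCanonicalGaussian 𝕜 c ν := by
  let _ : InnerProductSpace ℝ E := InnerProductSpace.rclikeToReal 𝕜 E
  obtain ⟨ι, U, hU⟩ := exists_white E
  set s : ℝ := Real.sqrt (((2 * c)⁻¹ : ℝ≥0) : ℝ) with hs
  have hs2 : s ^ 2 = (((2 * c)⁻¹ : ℝ≥0) : ℝ) := Real.sq_sqrt (NNReal.coe_nonneg _)
  let B := Module.Basis.ofVectorSpace 𝕜 E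
  have hmeas : ∀ f : Lp ℝ 2 (prodGauss ι), Measurable fun ω => f ω := fun f => (Lp.stronglyMeasurable f).measurable
  let z : (ι → ℝ) → _ → 𝕜 := fun ω b =>
    ((s * U (B b) ω : ℝ) : 𝕜) + RCLike.I * ((s * U ((RCLike.I : 𝕜) • B b) ω : ℝ) : 𝕜)
  let T : (ι → ℝ) → AlgDual 𝕜 E := fun ω => dualOfBasis 𝕜 E B (z ω)
  have hT : Measurable T := by
    rw [measurable_comap_iff, measurable_pi_iff]
    intro v
    simp only [Function.comp_def, T, dualOfBasis_apply]
    refine Finset.measurable_sum _ fun b _ => measurable_const.mul ?_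
    have h1 := hmeas (U (B b))
    have h2 := hmeas (U ((RCLike.I : 𝕜) • B b))
    exact (RCLike.measurable_ofReal.comp (h1.const_mul s)).add
      ((RCLike.measurable_ofReal.comp (h2.const_mul s)).const_mul _)
  have key : ∀ v, (fun ω => RCLike.re (T ω v)) =ᵐ[prodGauss ι] fun ω => s * U v ω := by
    intro v
    have hv : v = ∑ b ∈ (B.repr v).support,
        (RCLike.re (B.repr v b) • B b + RCLike.im (B.repr v b) • (RCLike.I : 𝕜) • B b) := by
      conv_lhs => rw [← B.linearCombination_repr v, Finsupp.linearCombination_apply, Finsupp.sum]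
      refine Finset.sum_congr rfl fun b _ => ?_
      conv_lhs => rw [← RCLike.re_add_im (B.repr v b), add_smul, mul_smul]
      rfl
    have hUv : ∀ t : Finset _, ((U (∑ b ∈ t,
        (RCLike.re (B.repr v b) • B b + RCLike.im (B.repr v b) • (RCLike.I : 𝕜) • B b)) :
          Lp ℝ 2 (prodGauss ι)) : (ι → ℝ) → ℝ) =ᵐ[prodGauss ι] fun ω => ∑ b ∈ t, (RCLike.re (B.repr v b) * U (B b) ω
          + RCLike.im (B.repr v b) * U ((RCLike.I : 𝕜) • B b) ω) := by
      classical
      intro t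
      induction t using Finset.induction_on with
      | empty =>
        simp only [Finset.sum_empty, map_zero]
        exact Lp.coeFn_zero ℝ 2 (prodGauss ι)
      | insert a t ha ih =>
        rw [Finset.sum_insert ha, map_add, map_add, map_smul, map_smul]
        set f := U (∑ b ∈ t,
          (RCLike.re (B.repr v b) • B b + RCLike.im (B.repr v b) • (RCLike.I : 𝕜) • B b))
        set x := RCLike.re (B.repr v a)
        set y := RCLike.im (B.repr v a)
        filter_upwards [ih, Lp.coeFn_add (x • U (B a) + y • U ((RCLike.I : 𝕜) • B a)) f,
          Lp.coeFn_add (x • U (B a)) (y • U ((RCLike.I : 𝕜) • B a)), Lp.coeFn_smul x (U (B a)),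
          Lp.coeFn_smul y (U ((RCLike.I : 𝕜) • B a))] with ω h1 h2 h3 h4 h5
        rw [Finset.sum_insert ha, h2, Pi.add_apply, h3, Pi.add_apply, h4, h5, h1]
        rfl
    have hUv' := hUv (B.repr v).support
    rw [← hv] at hUv'
    filter_upwards [hUv'] with ω hω
    rw [hω]
    simp only [T, dualOfBasis_apply, map_sum, Finset.mul_sum]
    refine Finset.sum_congr rfl fun b _ => ?_
    have hI : RCLike.im (B.repr v b) * RCLike.im (RCLike.I : 𝕜) = RCLike.im (B.repr v b) :=
      RCLike.mul_im_I_ax _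
    have hI' : RCLike.im (B.repr v b) * (RCLike.im (RCLike.I : 𝕜) *
        (s * U ((RCLike.I : 𝕜) • B b) ω)) = RCLike.im (B.repr v b) *
        (s * U ((RCLike.I : 𝕜) • B b) ω) := by rw [← mul_assoc, hI]
    simp [z]
    linear_combination hI'
  have cf : ∀ v : E, ∫ ω, Complex.exp ((RCLike.re (T ω v) : ℝ) * Complex.I) ∂(prodGauss ι) =
      Complex.exp (-((s ^ 2 * ‖v‖ ^ 2 : ℝ) : ℂ) / 2) := by
    intro v
    have h := hU (s • v)
    rw [norm_smul, mul_pow, Real.norm_eq_abs, sq_abs] at h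
    rw [← h]
    apply integral_congr_ae
    rw [map_smul]
    filter_upwards [key v, Lp.coeFn_smul s (U v)] with ω h1 h2
    rw [h1, h2]; rfl
  refine ⟨(prodGauss ι).map T, fun n e he => ?_⟩
  have hev : Measurable (fun (φ : AlgDual 𝕜 E) (i : Fin n) => RCLike.re (φ (e i))) := by
    rw [measurable_pi_iff]
    intro i
    refine RCLike.measurable_re.comp ?_
    exact (measurable_pi_apply (e i)).comp (comap_measurable _)
  rw [Measure.map_map hev hT]
  have : IsProbabilityMeasure ((prodGauss ι).map ((fun (φ : AlgDual 𝕜 E) (i : Fin n) => RCLike.re (φ (e i))) ∘ T)) :=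
    Measure.isProbabilityMeasure_map (hev.comp hT).aemeasurable
  refine Measure.ext_of_charFunDual (funext fun L => ?_)
  set t : Fin n → ℝ := fun i => L (Pi.single i 1) with ht
  have hL : ∀ x : Fin n → ℝ, L x = ∑ i, t i * x i := by
    intro x
    conv_lhs => rw [pi_eq_sum_univ' x, map_sum]
    refine Finset.sum_congr rfl fun i _ => ?_
    rw [map_smul, smul_eq_mul, mul_comm]
  rw [charFunDual_pi, charFunDual_apply, integral_map (hev.comp hT).aemeasurable
    (Continuous.aestronglyMeasurable (by fun_prop))]
  have hre : ∀ ω, L (((fun (φ : AlgDual 𝕜 E) (i : Fin n) => RCLike.re (φ (e i))) ∘ T) ω)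
      = RCLike.re (T ω (∑ i, ((t i : ℝ) : 𝕜) • e i)) := by
    intro ω
    rw [hL, map_sum, map_sum]
    refine Finset.sum_congr rfl fun i _ => ?_
    rw [LinearMap.map_smulₛₗ, RCLike.conj_ofReal, smul_eq_mul, RCLike.re_ofReal_mul]
    rfl
  simp_rw [hre]
  rw [cf]
  have hn : ‖∑ i, ((t i : ℝ) : 𝕜) • e i‖ ^ 2 = ∑ i, t i ^ 2 := by
    rw [@norm_sq_eq_re_inner 𝕜, sum_inner, map_sum]
    refine Finset.sum_congr rfl fun i _ => ?_
    rw [inner_sum, map_sum]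
    simp only [inner_smul_left, inner_smul_right, RCLike.conj_ofReal, RCLike.re_ofReal_mul, he]
    simp [sq]
  rw [hn]
  have h1 : ∀ i : Fin n, charFunDual (gaussianReal 0 (2 * c)⁻¹) (L.comp (.single ℝ (fun _ => ℝ) i))
      = Complex.exp (-((s ^ 2 * t i ^ 2 : ℝ) : ℂ) / 2) := by
    intro i
    rw [charFunDual_apply]
    have : ∀ x : ℝ, (L.comp (.single ℝ (fun _ => ℝ) i)) x = t i * x := by
      intro x
      simp only [ContinuousLinearMap.comp_apply, hL]
      simp [Pi.single_apply]
    simp_rw [this]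
    push_cast
    rw [← charFun_apply_real, charFun_gaussianReal]
    congr 1
    rw [← Complex.ofReal_pow s 2, hs2]
    simp
    ring
  simp_rw [h1]
  rw [← Complex.exp_sum]
  congr 1
  push_cast
  rw [← Finset.sum_div, Finset.sum_neg_distrib, Finset.mul_sum]

end Dual

section Integral
variable (𝕜 : Type*) [RCLike 𝕜] {E : Type*} [NormedAddCommGroup E] [InnerProductSpace 𝕜 E]

variable (E) in
/-- The canonical Gaussian measure on `Ê` of the inner product `c * re ⟪⬝, ⬝⟫`. -/
def gaussianMeasure (c : ℝ≥0) : Measure (AlgDual 𝕜 E) :=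
  (exists_isCanonicalGaussian 𝕜 E c).choose

theorem isCanonicalGaussian_gaussianMeasure (c : ℝ≥0) :
    IsCanonicalGaussian 𝕜 c (gaussianMeasure 𝕜 E c) :=
  (exists_isCanonicalGaussian 𝕜 E c).choose_spec

variable (E) in
/-- The directed set of the finite dimensional subspaces of `E`. -/
abbrev FinSubspace : Type _ := {V : Submodule 𝕜 E // FiniteDimensional 𝕜 V}

variable {𝕜} in
/-- The projection `Ê → V` onto a finite dimensional subspace `V`: the vector `y` of `V` with
`⟪v, y⟫ = φ v` for all `v` in `V`, written in an orthonormal basis. It extends the orthogonal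
projection `E → V`. -/
def FinSubspace.proj (V : FinSubspace 𝕜 E) (φ : AlgDual 𝕜 E) : E :=
  haveI := V.2
  ∑ i, φ (stdOrthonormalBasis 𝕜 V.1 i : E) • (stdOrthonormalBasis 𝕜 V.1 i : E)

/-- `F` is the `L¹`-extension to `Ê` of the function `f` on `E`: the cylinder functions
`φ ↦ f (φ_V)`, where `φ_V` is the projection of `φ` to the finite dimensional subspace `V`, converge
to `F` in `L¹` along the directed set of all `V`. (In infinite dimension `E` is a null set of `Ê`,
so that `f` does not define a class of functions on `Ê` in any more direct way. If `E` has finite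
dimension, then `Ê = E` and this says that `f` is integrable and almost everywhere equal to `F`.) -/
def IsL1Extension (c : ℝ≥0) (f : E → ℂ) (F : AlgDual 𝕜 E → ℂ) : Prop :=
  Integrable F (gaussianMeasure 𝕜 E c) ∧
  (∀ᶠ V : FinSubspace 𝕜 E in atTop,
    Integrable (fun φ => f (V.proj φ)) (gaussianMeasure 𝕜 E c)) ∧
  Tendsto (fun V : FinSubspace 𝕜 E =>
    ∫ φ, ‖f (V.proj φ) - F φ‖ ∂(gaussianMeasure 𝕜 E c)) atTop (𝓝 0)

/-- The function `f` on `E` is integrable with respect to the Gaussian measure on `Ê`. -/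
def GaussIntegrable (c : ℝ≥0) (f : E → ℂ) : Prop := ∃ F, IsL1Extension 𝕜 c f F

open Classical in
/-- The integral of `f` over `Ê` with respect to the Gaussian measure (and `0` if `f` is not
integrable). It does not depend on the choice of the extension of `f`, as `L¹`-limits are unique. -/
def gaussIntegral (c : ℝ≥0) (f : E → ℂ) : ℂ :=
  if h : GaussIntegrable 𝕜 c f then ∫ φ, h.choose φ ∂(gaussianMeasure 𝕜 E c) else 0

end Integral

/-! ### The complex conjugate of a Hilbert space -/

section Conj
variable (L : Type*) [NormedAddCommGroup L] [InnerProductSpace ℂ L]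

/-- The space of solutions on a hypersurface with the opposite orientation: the same real normed
space, with the conjugate scalar multiplication and the conjugate inner product. -/
def ConjSpace : Type _ := L

instance : NormedAddCommGroup (ConjSpace L) := inferInstanceAs (NormedAddCommGroup L)

instance [CompleteSpace L] : CompleteSpace (ConjSpace L) := inferInstanceAs (CompleteSpace L)

/-- The identity map `L → ConjSpace L`, which is conjugate linear. -/
def toConj : L → ConjSpace L := id

/-- The identity map `ConjSpace L → L`, which is conjugate linear. -/
def ofConj : ConjSpace L → L := id

instance : InnerProductSpace ℂ (ConjSpace L) where
  smul a x := toConj L (conj a • ofConj L x)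
  one_smul x := by
    change conj (1 : ℂ) • ofConj L x = ofConj L x
    simp
  mul_smul a b x := by
    change conj (a * b) • ofConj L x = conj a • conj b • ofConj L x
    rw [map_mul, mul_smul]
  smul_zero a := smul_zero (A := L) (conj a)
  smul_add a x y := smul_add (A := L) (conj a) (ofConj L x) (ofConj L y)
  add_smul a b x := by
    change conj (a + b) • ofConj L x = conj a • ofConj L x + conj b • ofConj L x
    rw [map_add, add_smul]
  zero_smul x := by
    change conj (0 : ℂ) • ofConj L x = 0
    simp
  norm_smul_le a x := by
    change ‖conj a • ofConj L x‖ ≤ ‖a‖ * ‖ofConj L x‖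
    rw [norm_smul, RCLike.norm_conj]
  inner x y := inner ℂ (ofConj L y) (ofConj L x)
  norm_sq_eq_re_inner x := norm_sq_eq_re_inner (𝕜 := ℂ) (ofConj L x)
  conj_inner_symm x y := inner_conj_symm (𝕜 := ℂ) (ofConj L y) (ofConj L x)
  add_left x y z := inner_add_right (𝕜 := ℂ) (ofConj L z) (ofConj L x) (ofConj L y)
  smul_left x y a := inner_smul_right (𝕜 := ℂ) (ofConj L y) (ofConj L x) (conj a)

end Conj

/-! ### States, regions and amplitudes

Throughout, `L` is the complex Hilbert space of solutions on a hypersurface, and states are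
represented by their values on `L`. -/

section Amplitudes
variable {L : Type*} [NormedAddCommGroup L] [InnerProductSpace ℂ L]

/-- The coherent state `K_ξ`. -/
def coherentState (ξ : L) : L → ℂ := fun φ => Complex.exp ((1 / 2 : ℂ) * ⟪ξ, φ⟫_ℂ)

/-- `f` is a square integrable holomorphic function on the finite dimensional subspace `V` of `L`,
regarded as a function on `L` by means of the orthogonal projection to `V`. -/
def IsCylinderState (V : FinSubspace ℂ L) (f : L → ℂ) : Prop :=
  (∀ x y : L, (∀ v ∈ V.1, ⟪v, x⟫_ℂ = ⟪v, y⟫_ℂ) → f x = f y) ∧ Differentiable ℂ f ∧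
    MemLp (fun φ => f (V.proj φ)) 2 (gaussianMeasure ℂ L (1 / 2))

variable (L) in
/-- The state space `H²(L̂, ν)`, for the Gaussian measure `ν` of the inner product `⟪⬝, ⬝⟫ / 2`: the
completion of the space of the square integrable holomorphic functions of finitely many variables,
realized as a space of functions on `L` by taking pointwise limits of `L²`-Cauchy sequences. -/
def stateSpace : Set (L → ℂ) :=
  {f | ∃ g : ℕ → L → ℂ,
    (∀ n, ∃ V, IsCylinderState V (g n)) ∧
    (∀ ε : ℝ≥0∞, 0 < ε → ∃ N, ∀ m ≥ N, ∀ n ≥ N, ∃ V,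
      IsCylinderState V (g m) ∧ IsCylinderState V (g n) ∧
      eLpNorm (fun φ => g m (V.proj φ) - g n (V.proj φ)) 2 (gaussianMeasure ℂ L (1 / 2)) < ε) ∧
    ∀ x, Tendsto (fun n => g n x) atTop (𝓝 (f x))}

variable (L) in
/-- The linear combinations of coherent states, a dense subspace of the state space. -/
def coherentSpan : Submodule ℂ (L → ℂ) := Submodule.span ℂ (Set.range coherentState)

/-- The conjugate linear map from the states on a hypersurface to the states on the same
hypersurface with opposite orientation. -/
def iota (ψ : L → ℂ) : ConjSpace L → ℂ := fun φ => conj (ψ (ofConj L φ))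

/-- The symplectic form `ω` on `L`. -/
def symplecticForm (φ η : L) : ℝ := (1 / 2) * (⟪φ, η⟫_ℂ).im

/-- The inner product `g = re ⟪⬝, ⬝⟫` on a real subspace of `L`. -/
abbrev realInnerProductSpace (R : Submodule ℝ L) : InnerProductSpace ℝ R :=
  letI : InnerProductSpace ℝ L := InnerProductSpace.complexToReal
  Submodule.innerProductSpace R

variable (L) in
/-- The classical data of a region `M`: the real vector space `X` of solutions in the interior and
the map `r` to the space `L` of solutions on the boundary, whose image is a closed Lagrangian
subspace (that is, it equals its orthogonal complement for the symplectic form). -/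
structure Region (X : Type*) [AddCommGroup X] [Module ℝ X] where
  r : X →ₗ[ℝ] L
  isClosed_range : IsClosed (LinearMap.range r : Set L)
  lagrangian : ∀ φ : L, φ ∈ LinearMap.range r ↔
    ∀ η ∈ LinearMap.range r, symplecticForm φ η = 0

variable {X : Type*} [AddCommGroup X] [Module ℝ X] (M : Region L X)

/-- The space of boundary solutions that extend to the interior. -/
abbrev Region.solutions : Submodule ℝ L := LinearMap.range M.r

/-- The restriction of `ψ` to the solutions that extend to the interior is integrable for the
Gaussian measure of the real inner product `g / 4`. -/
def Region.Integrable (ψ : L → ℂ) : Prop :=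
  letI := realInnerProductSpace M.solutions
  GaussIntegrable ℝ (1 / 4) (fun φ : M.solutions => ψ φ)

/-- The dense subspace of states on which the amplitude is considered: the elements of the state
space that are linear combinations of coherent states. The last condition says that the integral
that defines the amplitude exists. -/
def Region.domain : Set (L → ℂ) :=
  {ψ | ψ ∈ stateSpace L ∧ ψ ∈ coherentSpan L ∧ M.Integrable ψ}

/-- The amplitude of the region: the integral of the restriction of `ψ` to the solutions that
extend to the interior, for the Gaussian measure of the real inner product `g / 4`. -/
def Region.amplitude (ψ : L → ℂ) : ℂ :=
  letI := realInnerProductSpace M.solutions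
  gaussIntegral ℝ (1 / 4) (fun φ : M.solutions => ψ φ)

end Amplitudes

/-! ### Gluing -/

section Gluing
variable (L₁ LS : Type*) [NormedAddCommGroup L₁] [InnerProductSpace ℂ L₁]
  [NormedAddCommGroup LS] [InnerProductSpace ℂ LS]

/-- The space of solutions on the boundary `Σ₁ ∪ Σ ∪ Σ̄'`, where `Σ'` is a copy of `Σ`: the
orthogonal direct sum of the spaces of `Σ₁`, of `Σ`, and the conjugate of that of `Σ`. -/
abbrev Boundary : Type _ := WithLp 2 (L₁ × WithLp 2 (LS × ConjSpace LS))

variable {L₁ LS} in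
/-- The state `ψ ⊗ χ ⊗ χ'` on the boundary `Σ₁ ∪ Σ ∪ Σ̄'`. -/
def tensor₃ (ψ : L₁ → ℂ) (χ : LS → ℂ) (χ' : ConjSpace LS → ℂ) : Boundary L₁ LS → ℂ :=
  fun φ => ψ φ.fst * χ φ.snd.fst * χ' φ.snd.snd

/-- The classical data of a gluing: a region `M` with boundary `Σ₁ ∪ Σ ∪ Σ̄'`, the region `M₁` with
boundary `Σ₁` that is the result of gluing `M` to itself along `Σ` and `Σ̄'`, and the injective map
from the solutions in `M₁` to those in `M`, whose image consists of the solutions that induce the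
same solution on `Σ` and on `Σ'`, and which is compatible with the restriction to `Σ₁`. -/
structure GluingData (X X₁ : Type*) [AddCommGroup X] [Module ℝ X] [AddCommGroup X₁]
    [Module ℝ X₁] where
  M : Region (Boundary L₁ LS) X
  M₁ : Region L₁ X₁
  glue : X₁ →ₗ[ℝ] X
  glue_injective : Function.Injective glue
  range_glue : ∀ x : X, x ∈ LinearMap.range glue ↔ (M.r x).snd.fst = ofConj LS (M.r x).snd.snd
  r_glue : ∀ x : X₁, (M.r (glue x)).fst = M₁.r x

variable {L₁ LS} {X X₁ : Type*} [AddCommGroup X] [Module ℝ X] [AddCommGroup X₁] [Module ℝ X₁]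
  (G : GluingData L₁ LS X X₁)

/-- The function `ξ ↦ ρ_M (ψ ⊗ K_ξ ⊗ ι(K_ξ))`. -/
def GluingData.integrand (ψ : L₁ → ℂ) (ξ : LS) : ℂ :=
  G.M.amplitude (tensor₃ ψ (coherentState ξ) (iota (coherentState ξ)))

/-- The integral of `ξ ↦ ρ_M (ψ ⊗ K_ξ ⊗ ι(K_ξ))` for the Gaussian measure of `Σ`, which is that of
the inner product `⟪⬝, ⬝⟫ / 2`. -/
def GluingData.integral (ψ : L₁ → ℂ) : ℂ := gaussIntegral ℂ (1 / 2) (G.integrand ψ)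

/-- The integrability condition. -/
def GluingData.IntegrabilityCondition : Prop :=
  GaussIntegrable ℂ (1 / 2) (G.integrand (coherentState 0)) ∧ G.integral (coherentState 0) ≠ 0

/-- The gluing axiom in the form with coherent states, with the gluing anomaly factor `c`. -/
def GluingData.GluingAxiom (c : ℂ) : Prop :=
  c ≠ 0 ∧ ∀ ψ ∈ G.M₁.domain,
    (∀ ξ : LS, tensor₃ ψ (coherentState ξ) (iota (coherentState ξ)) ∈ G.M.domain) ∧
    GaussIntegrable ℂ (1 / 2) (G.integrand ψ) ∧
    G.M₁.amplitude ψ * c = G.integral ψ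

end Gluing

end HoloQuant

end

noncomputable section
namespace HoloQuant

/-! ### Gaussian integrals of exponentials and the Cameron–Martin formula on cylinder functions. -/

section Cylinder
variable {𝕜 : Type*} [RCLike 𝕜] {E : Type*} [NormedAddCommGroup E] [InnerProductSpace 𝕜 E]

/-! Let R be the image of the solutions of `M` and u the real orthogonal reflection in R. That R is
Lagrangian means that the boundary space is the orthogonal sum of R and iR, so u is antilinear, and
a Gaussian integral gives ρ_M(K_ξ) = exp(¼⟪ξ, uξ⟫) (`Region.exists_conjugation`,
`Region.amplitude_coherentState`). The product K_τ ⊗ K_ξ ⊗ ι(K_ξ) is itself the coherent state of jτ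
+ dξ, where j is the inclusion of the first summand and d the diagonal embedding. Hence the
integrand is exp(¼B(ξ, ξ)), for a fixed complex quadratic form B, times a constant and the
exponential of a real-linear form in ξ, both depending on τ (`DiagonalModel.kernel_eq`).

Integrability for all τ has to come from integrability for τ = 0. On a finite dimensional V the
measure |exp(¼B)|ν is a centered Gaussian up to normalization, so the variance of a coordinate can
be read off from one value of its Fourier transform. L¹-convergence makes these transforms converge
to that of |F|ν, where F is the extension of exp(¼B); this limit is continuous and positive at 0
because ∫F ≠ 0. Thus the variances, and with them all exponential moments, are eventually bounded
(`hasExpMoments_quadExp`), which is enough to preserve L¹-convergence under multiplication by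
exponentials of linear forms (`HasExpMoments.isL1Extension_mul_exp`).

For the value, let α be a boundary solution of `M₁`. By the gluing data there is σ with jα + dσ in
R. Translation by σ turns the integrand of α into exp(¼⟪α, α⟫) times that of 0
(`DiagonalModel.gaussIntegral_kernel_of_isReal`). Analytic continuation in a complex parameter
extends this to α + iβ (`DiagonalModel.gaussIntegral_kernel`), and every τ has this form. The factor
that appears is exactly ρ_{M₁}(K_τ). Linearity finishes the existence, and ψ = K_0, whose amplitude
is 1, determines c. -/

theorem measurable_eval (v : E) : Measurable fun φ : AlgDual 𝕜 E => φ v :=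
  (measurable_pi_apply v).comp (comap_measurable _)

theorem measurable_re_eval (v : E) : Measurable fun φ : AlgDual 𝕜 E => RCLike.re (φ v) :=
  RCLike.measurable_re.comp (measurable_eval v)

/-- The defining property of ν for the empty orthonormal family already fixes the total mass. -/
instance (c : ℝ≥0) : IsProbabilityMeasure (gaussianMeasure 𝕜 E c) := by
  have h := isCanonicalGaussian_gaussianMeasure 𝕜 (E := E) c 0 Fin.elim0 (fun i => i.elim0)
  have hm : Measurable fun (φ : AlgDual 𝕜 E) (i : Fin 0) => RCLike.re (φ (i.elim0 : E)) :=
    measurable_pi_iff.2 fun i => i.elim0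
  constructor
  rw [← Set.preimage_univ (f := fun (φ : AlgDual 𝕜 E) (i : Fin 0) => RCLike.re (φ (i.elim0 : E))),
    ← Measure.map_apply hm MeasurableSet.univ, h, measure_univ]

theorem FinSubspace.proj_mem (V : FinSubspace 𝕜 E) (φ : AlgDual 𝕜 E) : V.proj φ ∈ V.1 :=
  Submodule.sum_mem _ fun _ _ => V.1.smul_mem _ (Subtype.coe_prop _)

/-- This makes cylinder functions of `⟪v, ·⟫` independent of V as soon as V contains v, so that for
linear exponentials the limit over V is an eventual equality. -/
theorem FinSubspace.inner_proj (V : FinSubspace 𝕜 E) (φ : AlgDual 𝕜 E) {v : E} (hv : v ∈ V.1) :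
    ⟪v, V.proj φ⟫_𝕜 = φ v := by
  have := V.2
  have h : v = ∑ i, ⟪stdOrthonormalBasis 𝕜 V.1 i, (⟨v, hv⟩ : V.1)⟫_𝕜 •
      (stdOrthonormalBasis 𝕜 V.1 i : E) := by
    have := congrArg (Subtype.val) ((stdOrthonormalBasis 𝕜 V.1).sum_repr' ⟨v, hv⟩)
    simpa using this.symm
  conv_rhs => rw [h, map_sum]
  rw [FinSubspace.proj, inner_sum]
  refine Finset.sum_congr rfl fun i _ => ?_
  rw [inner_smul_right, LinearMap.map_smulₛₗ, smul_eq_mul, mul_comm, inner_conj_symm]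
  rfl

variable (𝕜) in
/-- Vectors of a finite dimensional space `W` of an inner product space over `𝕜`, in coordinates
with respect to a basis that is orthonormal for the real inner product. -/
theorem exists_re_orthonormal (W : Submodule 𝕜 E) [FiniteDimensional 𝕜 W] :
    ∃ (n : ℕ) (e : Fin n → E), (∀ i, e i ∈ W) ∧
      (∀ i j, RCLike.re ⟪e i, e j⟫_𝕜 = if i = j then (1 : ℝ) else 0) ∧
      ∀ x ∈ W, x = ∑ i, ((RCLike.re ⟪e i, x⟫_𝕜 : ℝ) : 𝕜) • e i := by
  let _ : InnerProductSpace ℝ W := InnerProductSpace.rclikeToReal 𝕜 W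
  have : FiniteDimensional ℝ W := FiniteDimensional.trans ℝ 𝕜 W
  let b := stdOrthonormalBasis ℝ W
  refine ⟨_, fun i => (b i : E), fun i => (b i).2, fun i j => ?_, fun x hx => ?_⟩
  · exact orthonormal_iff_ite.1 b.orthonormal i j
  · have h := congrArg Subtype.val (b.sum_repr' ⟨x, hx⟩)
    rw [Submodule.coe_sum] at h
    refine h.symm.trans (Finset.sum_congr rfl fun i _ => ?_)
    rfl

theorem integral_pi_exp (v : ℝ≥0) {n : ℕ} (z : Fin n → ℂ) :
    Integrable (fun x : Fin n → ℝ => Complex.exp (∑ i, z i * x i))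
      (Measure.pi fun _ => gaussianReal 0 v) ∧
    ∫ x : Fin n → ℝ, Complex.exp (∑ i, z i * x i) ∂(Measure.pi fun _ => gaussianReal 0 v)
      = Complex.exp (v * (∑ i, z i ^ 2) / 2) := by
  have h1 : ∀ z : ℂ, Integrable (fun x : ℝ => Complex.exp (z * x)) (gaussianReal 0 v) := by
    intro z
    exact integrable_cexp_mul_of_re_mem_integrableExpSet (X := id) aemeasurable_id
      (integrable_exp_mul_gaussianReal (μ := 0) (v := v) z.re)
  simp_rw [Complex.exp_sum]
  refine ⟨Integrable.fintype_prod (f := fun i (x : ℝ) => Complex.exp (z i * x)) fun i => h1 _, ?_⟩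
  rw [integral_fintype_prod_eq_prod (f := fun i (x : ℝ) => Complex.exp (z i * x))]
  have h2 : ∀ z : ℂ, ∫ x : ℝ, Complex.exp (z * x) ∂(gaussianReal 0 v)
      = Complex.exp (v * z ^ 2 / 2) := by
    intro z
    simpa [complexMGF] using complexMGF_id_gaussianReal (μ := 0) (v := v) z
  simp_rw [h2]
  rw [← Complex.exp_sum, Finset.mul_sum, Finset.sum_div]

/-- In real orthonormal coordinates e_i of the span of a and b, the exponent is linear with
coefficients α_i + iβ_i, and Σ(α_i + iβ_i)² = ‖a‖² − ‖b‖² + 2i re⟪a, b⟫. -/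
theorem exp_eval (c : ℝ≥0) (a b : E) :
    Integrable (fun φ : AlgDual 𝕜 E => Complex.exp ((RCLike.re (φ a) : ℝ) +
      (RCLike.re (φ b) : ℝ) * Complex.I)) (gaussianMeasure 𝕜 E c) ∧
    ∫ φ, Complex.exp ((RCLike.re (φ a) : ℝ) + (RCLike.re (φ b) : ℝ) * Complex.I)
      ∂(gaussianMeasure 𝕜 E c) = Complex.exp ((((2 * c)⁻¹ : ℝ≥0) : ℝ) *
        ((‖a‖ ^ 2 - ‖b‖ ^ 2 : ℝ) + 2 * (RCLike.re ⟪a, b⟫_𝕜 : ℝ) * Complex.I) / 2) := by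
  have : FiniteDimensional 𝕜 (Submodule.span 𝕜 {a, b}) :=
    FiniteDimensional.span_of_finite 𝕜 (by simp)
  obtain ⟨n, e, -, he, hW⟩ := exists_re_orthonormal 𝕜 (Submodule.span 𝕜 {a, b})
  have ha := hW a (Submodule.subset_span (by simp))
  have hb := hW b (Submodule.subset_span (by simp))
  set α : Fin n → ℝ := fun i => RCLike.re ⟪e i, a⟫_𝕜 with hα
  set β : Fin n → ℝ := fun i => RCLike.re ⟪e i, b⟫_𝕜 with hβ
  have hm : Measurable fun (φ : AlgDual 𝕜 E) (i : Fin n) => RCLike.re (φ (e i)) :=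
    measurable_pi_iff.2 fun i => measurable_re_eval _
  have hev : ∀ (t : Fin n → ℝ) (x : E) (_ : x = ∑ i, ((t i : ℝ) : 𝕜) • e i) (φ : AlgDual 𝕜 E),
      RCLike.re (φ x) = ∑ i, t i * RCLike.re (φ (e i)) := by
    intro t x hx φ
    rw [hx, map_sum, map_sum]
    refine Finset.sum_congr rfl fun i _ => ?_
    rw [LinearMap.map_smulₛₗ, RCLike.conj_ofReal, smul_eq_mul, RCLike.re_ofReal_mul]
  have hfun : (fun φ : AlgDual 𝕜 E => Complex.exp ((RCLike.re (φ a) : ℝ) +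
      (RCLike.re (φ b) : ℝ) * Complex.I)) = (fun x : Fin n → ℝ => Complex.exp (∑ i,
        ((α i : ℂ) + β i * Complex.I) * x i)) ∘ (fun (φ : AlgDual 𝕜 E) (i : Fin n) =>
          RCLike.re (φ (e i))) := by
    ext φ
    simp only [Function.comp_apply]
    rw [hev α a ha φ, hev β b hb φ]
    congr 1
    push_cast
    rw [Finset.sum_mul, ← Finset.sum_add_distrib]
    exact Finset.sum_congr rfl fun i _ => by ring
  have hin : ∀ (s t : Fin n → ℝ) (x y : E) (_ : x = ∑ i, ((s i : ℝ) : 𝕜) • e i)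
      (_ : y = ∑ i, ((t i : ℝ) : 𝕜) • e i), RCLike.re ⟪x, y⟫_𝕜 = ∑ i, s i * t i := by
    intro s t x y hx hy
    rw [hx, hy, sum_inner, map_sum]
    refine Finset.sum_congr rfl fun i _ => ?_
    rw [inner_sum, map_sum]
    simp only [inner_smul_left, inner_smul_right, RCLike.conj_ofReal, RCLike.re_ofReal_mul, he]
    simp [mul_comm]
  have hmap := isCanonicalGaussian_gaussianMeasure 𝕜 (E := E) c n e he
  have hc : Continuous fun x : Fin n → ℝ => Complex.exp (∑ i, ((α i : ℂ) + β i * Complex.I) * x i) := by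
    fun_prop
  obtain ⟨h1, h2⟩ := integral_pi_exp (2 * c)⁻¹ fun i => (α i : ℂ) + β i * Complex.I
  rw [← hmap] at h1 h2
  constructor
  · rw [hfun]
    exact h1.comp_measurable hm
  · rw [integral_map hm.aemeasurable hc.aestronglyMeasurable] at h2
    rw [hfun]
    refine h2.trans ?_
    congr 2
    have na := @norm_sq_eq_re_inner 𝕜 _ _ _ _ a
    have nb := @norm_sq_eq_re_inner 𝕜 _ _ _ _ b
    rw [hin α α a a ha ha] at na
    rw [hin β β b b hb hb] at nb
    rw [na, nb, hin α β a b ha hb]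
    push_cast
    congr 1
    rw [← Finset.sum_sub_distrib, Finset.mul_sum, Finset.sum_mul, ← Finset.sum_add_distrib]
    refine Finset.sum_congr rfl fun i _ => ?_
    linear_combination (β i : ℂ) ^ 2 * Complex.I_sq

/-- The characteristic functions of both sides are Gaussian integrals given by `exp_eval`. With κ =
1/2 the real coordinates have variance one, which explains the weight exp(−re φ(s) − ‖s‖²/2). -/
theorem map_shift_withDensity {n : ℕ} (e : Fin n → E) (s : E) :
    ((gaussianMeasure 𝕜 E (1 / 2)).withDensity
        fun φ => ENNReal.ofReal (Real.exp (-RCLike.re (φ s) - ‖s‖ ^ 2 / 2))).map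
      (fun φ i => RCLike.re (φ (e i)) + RCLike.re ⟪e i, s⟫_𝕜) =
    (gaussianMeasure 𝕜 E (1 / 2)).map fun φ i => RCLike.re (φ (e i)) := by
  set ν := gaussianMeasure 𝕜 E (1 / 2)
  set w : AlgDual 𝕜 E → ℝ := fun φ => Real.exp (-RCLike.re (φ s) - ‖s‖ ^ 2 / 2) with hw
  have hwm : Measurable w := (((measurable_re_eval s).neg).sub_const _).exp
  have hwi : Integrable w ν := by
    have h := ((exp_eval (𝕜 := 𝕜) (1 / 2) (-s) 0).1.norm).mul_const (Real.exp (-(‖s‖ ^ 2 / 2)))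
    refine h.congr (Eventually.of_forall fun φ => ?_)
    simp [hw, Complex.norm_exp, sub_eq_add_neg, Real.exp_add]
  have : IsFiniteMeasure (ν.withDensity fun φ => ENNReal.ofReal (w φ)) :=
    isFiniteMeasure_withDensity_ofReal hwi.2
  have hX : Measurable fun (φ : AlgDual 𝕜 E) (i : Fin n) => RCLike.re (φ (e i)) :=
    measurable_pi_iff.2 fun i => measurable_re_eval _
  have hY : Measurable fun (φ : AlgDual 𝕜 E) (i : Fin n) =>
      RCLike.re (φ (e i)) + RCLike.re ⟪e i, s⟫_𝕜 :=
    measurable_pi_iff.2 fun i => (measurable_re_eval _).add_const _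
  refine Measure.ext_of_charFunDual (funext fun L => ?_)
  set t : Fin n → ℝ := fun i => L (Pi.single i 1) with ht
  have hL : ∀ x : Fin n → ℝ, L x = ∑ i, t i * x i := by
    intro x
    conv_lhs => rw [pi_eq_sum_univ' x, map_sum]
    refine Finset.sum_congr rfl fun i _ => ?_
    rw [map_smul, smul_eq_mul, mul_comm]
  set b : E := ∑ i, ((t i : ℝ) : 𝕜) • e i with hb
  have hLφ : ∀ φ : AlgDual 𝕜 E, L (fun i => RCLike.re (φ (e i))) = RCLike.re (φ b) := by
    intro φ
    rw [hL, hb, map_sum, map_sum]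
    refine Finset.sum_congr rfl fun i _ => ?_
    rw [LinearMap.map_smulₛₗ, RCLike.conj_ofReal, smul_eq_mul, RCLike.re_ofReal_mul]
  have hLs : L (fun i => RCLike.re ⟪e i, s⟫_𝕜) = RCLike.re ⟪b, s⟫_𝕜 := by
    rw [hL, hb, sum_inner, map_sum]
    refine Finset.sum_congr rfl fun i _ => ?_
    rw [inner_smul_left, RCLike.conj_ofReal, RCLike.re_ofReal_mul]
  rw [charFunDual_apply, charFunDual_apply, integral_map hY.aemeasurable
    (Continuous.aestronglyMeasurable (by fun_prop)), integral_map hX.aemeasurable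
    (Continuous.aestronglyMeasurable (by fun_prop)),
    integral_withDensity_eq_integral_toReal_smul hwm.ennreal_ofReal (by simp)]
  simp_rw [hLφ]
  have e1 : ∀ φ : AlgDual 𝕜 E, (ENNReal.ofReal (w φ)).toReal • Complex.exp
      ((L (fun i => RCLike.re (φ (e i)) + RCLike.re ⟪e i, s⟫_𝕜) : ℝ) * Complex.I) =
      Complex.exp ((RCLike.re ⟪b, s⟫_𝕜 : ℝ) * Complex.I - (‖s‖ ^ 2 / 2 : ℝ)) *
      Complex.exp ((RCLike.re (φ (-s)) : ℝ) + (RCLike.re (φ b) : ℝ) * Complex.I) := by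
    intro φ
    have : (fun i => RCLike.re (φ (e i)) + RCLike.re ⟪e i, s⟫_𝕜) =
      (fun i => RCLike.re (φ (e i))) + fun i => RCLike.re ⟪e i, s⟫_𝕜 := rfl
    rw [this, map_add, hLφ, hLs, ENNReal.toReal_ofReal (Real.exp_pos _).le, Complex.real_smul,
      Complex.ofReal_exp, ← Complex.exp_add, ← Complex.exp_add, map_neg, map_neg]
    congr 1
    push_cast
    ring
  simp_rw [e1]
  rw [integral_const_mul, (exp_eval _ _ _).2, ← Complex.exp_add]
  have e2 := (exp_eval (𝕜 := 𝕜) (1 / 2) (0 : E) b).2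
  simp only [map_zero, Complex.ofReal_zero, zero_add] at e2
  rw [e2]
  congr 1
  rw [norm_neg, inner_neg_left, map_neg, ← inner_conj_symm, RCLike.conj_re]
  simp
  ring

/-- Because s lies in V, the functions g(φ_V) and g(φ_V + s) depend only on finitely many
coordinates of φ and on their translates, so `map_shift_withDensity` applies. -/
theorem FinSubspace.cameronMartin (V : FinSubspace 𝕜 E) {s : E} (hs : s ∈ V.1) {g : E → ℂ}
    (hg : Continuous g) :
    (Integrable (fun φ => (Real.exp (-RCLike.re (φ s) - ‖s‖ ^ 2 / 2) : ℂ) * g (V.proj φ + s))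
      (gaussianMeasure 𝕜 E (1 / 2)) ↔
      Integrable (fun φ => g (V.proj φ)) (gaussianMeasure 𝕜 E (1 / 2))) ∧
    ∫ φ, (Real.exp (-RCLike.re (φ s) - ‖s‖ ^ 2 / 2) : ℂ) * g (V.proj φ + s)
      ∂(gaussianMeasure 𝕜 E (1 / 2)) = ∫ φ, g (V.proj φ) ∂(gaussianMeasure 𝕜 E (1 / 2)) := by
  have := V.2
  obtain ⟨n, e, heV, -, hV⟩ := exists_re_orthonormal 𝕜 V.1
  set ν := gaussianMeasure 𝕜 E (1 / 2)
  set w : AlgDual 𝕜 E → ℝ := fun φ => Real.exp (-RCLike.re (φ s) - ‖s‖ ^ 2 / 2) with hw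
  have hwm : Measurable w := (((measurable_re_eval s).neg).sub_const _).exp
  have hX : Measurable fun (φ : AlgDual 𝕜 E) (i : Fin n) => RCLike.re (φ (e i)) :=
    measurable_pi_iff.2 fun i => measurable_re_eval _
  have hY : Measurable fun (φ : AlgDual 𝕜 E) (i : Fin n) =>
      RCLike.re (φ (e i)) + RCLike.re ⟪e i, s⟫_𝕜 :=
    measurable_pi_iff.2 fun i => (measurable_re_eval _).add_const _
  set G : (Fin n → ℝ) → ℂ := fun x => g (∑ i, ((x i : ℝ) : 𝕜) • e i) with hG
  have hGc : Continuous G := hg.comp (continuous_finsetSum _ fun i _ =>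
    (RCLike.continuous_ofReal.comp (continuous_apply i)).smul continuous_const)
  have h1 : ∀ φ : AlgDual 𝕜 E, g (V.proj φ) = G fun i => RCLike.re (φ (e i)) := by
    intro φ
    conv_lhs => rw [hV _ (V.proj_mem φ)]
    simp_rw [V.inner_proj φ (heV _)]
    rfl
  have h2 : ∀ φ : AlgDual 𝕜 E,
      g (V.proj φ + s) = G fun i => RCLike.re (φ (e i)) + RCLike.re ⟪e i, s⟫_𝕜 := by
    intro φ
    conv_lhs => rw [hV _ (V.1.add_mem (V.proj_mem φ) hs)]
    simp_rw [inner_add_right, V.inner_proj φ (heV _)]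
    simp only [hG, map_add]
  have h3 : ∀ φ : AlgDual 𝕜 E, (Real.exp (-RCLike.re (φ s) - ‖s‖ ^ 2 / 2) : ℂ) * g (V.proj φ + s) =
      (ENNReal.ofReal (w φ)).toReal • G fun i => RCLike.re (φ (e i)) + RCLike.re ⟪e i, s⟫_𝕜 := by
    intro φ
    rw [ENNReal.toReal_ofReal (Real.exp_pos _).le, Complex.real_smul, h2]
  have hmap := map_shift_withDensity (𝕜 := 𝕜) e s
  simp_rw [h1, h3]
  constructor
  · rw [← integrable_withDensity_iff_integrable_smul' hwm.ennreal_ofReal (by simp)]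
    have a1 := integrable_map_measure (μ := ν) hGc.aestronglyMeasurable hX.aemeasurable
    have a2 := integrable_map_measure (μ := ν.withDensity fun φ => ENNReal.ofReal (w φ))
      hGc.aestronglyMeasurable hY.aemeasurable
    rw [hmap] at a2
    exact a2.symm.trans a1
  · rw [← integral_withDensity_eq_integral_toReal_smul hwm.ennreal_ofReal (by simp),
      ← integral_map hX.aemeasurable hGc.aestronglyMeasurable, ← hmap,
      integral_map hY.aemeasurable hGc.aestronglyMeasurable]

end Cylinder

/-! ### Limits of cylinder functions in L¹, and linearity of the integral. -/

section L1Extension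
variable {𝕜 : Type*} [RCLike 𝕜] {E : Type*} [NormedAddCommGroup E] [InnerProductSpace 𝕜 E]

instance : IsDirectedOrder (FinSubspace 𝕜 E) :=
  ⟨fun V W => by
    have := V.2
    have := W.2
    exact ⟨⟨V.1 ⊔ W.1, inferInstance⟩, Subtype.coe_le_coe.1 le_sup_left,
      Subtype.coe_le_coe.1 le_sup_right⟩⟩

instance : Nonempty (FinSubspace 𝕜 E) := ⟨⟨⊥, inferInstance⟩⟩

variable (𝕜) in
theorem FinSubspace.eventually_mem (v : E) : ∀ᶠ V : FinSubspace 𝕜 E in atTop, v ∈ V.1 := by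
  filter_upwards [eventually_ge_atTop
    (⟨Submodule.span 𝕜 {v}, FiniteDimensional.span_of_finite 𝕜 (by simp)⟩ : FinSubspace 𝕜 E)]
    with V hV
  exact (show Submodule.span 𝕜 {v} ≤ V.1 from hV) (Submodule.subset_span rfl)

variable {c : ℝ≥0} {f g : E → ℂ} {F G : AlgDual 𝕜 E → ℂ}

/-- Bounded test functions B give access to the limit: characters yield Fourier transforms, and
truncated exponentials yield moment bounds. -/
theorem IsL1Extension.tendsto_integral_mul (h : IsL1Extension 𝕜 c f F) {B : AlgDual 𝕜 E → ℂ}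
    (hB : Measurable B) (hb : ∀ φ, ‖B φ‖ ≤ 1) :
    Tendsto (fun V : FinSubspace 𝕜 E => ∫ φ, f (V.proj φ) * B φ ∂(gaussianMeasure 𝕜 E c)) atTop
      (𝓝 (∫ φ, F φ * B φ ∂(gaussianMeasure 𝕜 E c))) := by
  obtain ⟨hF, hV, hlim⟩ := h
  rw [tendsto_iff_norm_sub_tendsto_zero]
  refine squeeze_zero' (Eventually.of_forall fun _ => norm_nonneg _) ?_ hlim
  filter_upwards [hV] with V hi
  have hm : ∀ {H : AlgDual 𝕜 E → ℂ}, Integrable H (gaussianMeasure 𝕜 E c) →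
      Integrable (fun φ => H φ * B φ) (gaussianMeasure 𝕜 E c) := fun hH =>
    hH.mul_bdd hB.aestronglyMeasurable (Eventually.of_forall hb)
  rw [← integral_sub (hm hi) (hm hF)]
  refine norm_integral_le_of_norm_le (hi.sub hF).norm (Eventually.of_forall fun φ => ?_)
  rw [← sub_mul, norm_mul]
  exact mul_le_of_le_one_right (norm_nonneg _) (hb φ)

theorem IsL1Extension.tendsto_integral (h : IsL1Extension 𝕜 c f F) :
    Tendsto (fun V : FinSubspace 𝕜 E => ∫ φ, f (V.proj φ) ∂(gaussianMeasure 𝕜 E c)) atTop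
      (𝓝 (∫ φ, F φ ∂(gaussianMeasure 𝕜 E c))) := by
  simpa using h.tendsto_integral_mul (B := fun _ => 1) measurable_const (by simp)

/-- The chosen extension and the given one have integrals that are limits of the same net. -/
theorem IsL1Extension.gaussIntegral_eq (h : IsL1Extension 𝕜 c f F) :
    gaussIntegral 𝕜 c f = ∫ φ, F φ ∂(gaussianMeasure 𝕜 E c) := by
  have h' : GaussIntegrable 𝕜 c f := ⟨F, h⟩
  rw [gaussIntegral, dif_pos h']
  exact tendsto_nhds_unique h'.choose_spec.tendsto_integral h.tendsto_integral

theorem IsL1Extension.norm (h : IsL1Extension 𝕜 c f F) :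
    IsL1Extension 𝕜 c (fun x => (‖f x‖ : ℂ)) (fun φ => (‖F φ‖ : ℂ)) := by
  obtain ⟨hF, hV, hlim⟩ := h
  refine ⟨hF.norm.ofReal, hV.mono fun V hi => hi.norm.ofReal, ?_⟩
  refine squeeze_zero' (Eventually.of_forall fun _ => integral_nonneg fun _ => norm_nonneg _) ?_ hlim
  filter_upwards [hV] with V hi
  refine integral_mono_of_nonneg (Eventually.of_forall fun _ => norm_nonneg _) (hi.sub hF).norm
    (Eventually.of_forall fun φ => ?_)
  simp only [← Complex.ofReal_sub, Complex.norm_real]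
  exact abs_norm_sub_norm_le _ _

theorem IsL1Extension.add (hf : IsL1Extension 𝕜 c f F) (hg : IsL1Extension 𝕜 c g G) :
    IsL1Extension 𝕜 c (fun x => f x + g x) (fun φ => F φ + G φ) := by
  obtain ⟨hF, hV, hlim⟩ := hf
  obtain ⟨hG, hW, hlim'⟩ := hg
  refine ⟨hF.add hG, ?_, ?_⟩
  · filter_upwards [hV, hW] with V h1 h2 using h1.add h2
  · have h0 := hlim.add hlim'
    rw [add_zero] at h0
    refine squeeze_zero' (Eventually.of_forall fun _ => integral_nonneg fun _ => norm_nonneg _) ?_ h0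
    filter_upwards [hV, hW] with V h1 h2
    refine le_of_le_of_eq ?_ (integral_add (h1.sub hF).norm (h2.sub hG).norm)
    refine integral_mono_of_nonneg (Eventually.of_forall fun _ => norm_nonneg _)
      ((h1.sub hF).norm.add (h2.sub hG).norm) (Eventually.of_forall fun φ => ?_)
    simp only [add_sub_add_comm]
    exact norm_add_le _ _

theorem IsL1Extension.const_mul (a : ℂ) (hf : IsL1Extension 𝕜 c f F) :
    IsL1Extension 𝕜 c (fun x => a * f x) (fun φ => a * F φ) := by
  obtain ⟨hF, hV, hlim⟩ := hf
  refine ⟨hF.const_mul a, hV.mono fun V hi => hi.const_mul a, ?_⟩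
  have h0 := hlim.const_mul ‖a‖
  rw [mul_zero] at h0
  refine h0.congr fun V => ?_
  rw [← integral_const_mul]
  simp only [← mul_sub, norm_mul]

theorem IsL1Extension.of_eventually_eq (hF : Integrable F (gaussianMeasure 𝕜 E c))
    (h : ∀ᶠ V : FinSubspace 𝕜 E in atTop, ∀ φ, f (V.proj φ) = F φ) : IsL1Extension 𝕜 c f F := by
  refine ⟨hF, h.mono fun V hV => by simpa only [hV] using hF, ?_⟩
  refine tendsto_const_nhds.congr' (f₁ := fun _ => (0 : ℝ)) (h.mono fun V hV => ?_)
  simp [hV]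

theorem gaussIntegral_add (hf : GaussIntegrable 𝕜 c f) (hg : GaussIntegrable 𝕜 c g) :
    gaussIntegral 𝕜 c (fun x => f x + g x) = gaussIntegral 𝕜 c f + gaussIntegral 𝕜 c g := by
  obtain ⟨F, hF⟩ := hf
  obtain ⟨G, hG⟩ := hg
  rw [(hF.add hG).gaussIntegral_eq, hF.gaussIntegral_eq, hG.gaussIntegral_eq,
    integral_add hF.1 hG.1]

theorem gaussIntegral_const_mul (a : ℂ) (hf : GaussIntegrable 𝕜 c f) :
    gaussIntegral 𝕜 c (fun x => a * f x) = a * gaussIntegral 𝕜 c f := by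
  obtain ⟨F, hF⟩ := hf
  rw [(hF.const_mul a).gaussIntegral_eq, hF.gaussIntegral_eq, integral_const_mul]

variable (𝕜 c) in
/-- The functions `exp (re ⟪a, x⟫ + i re ⟪b, x⟫)` are integrable, with the obvious extension. -/
theorem isL1Extension_exp (a b : E) :
    IsL1Extension 𝕜 c (fun x => Complex.exp ((RCLike.re ⟪a, x⟫_𝕜 : ℝ) +
        (RCLike.re ⟪b, x⟫_𝕜 : ℝ) * Complex.I))
      (fun φ => Complex.exp ((RCLike.re (φ a) : ℝ) + (RCLike.re (φ b) : ℝ) * Complex.I)) := by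
  refine .of_eventually_eq (exp_eval c a b).1 ?_
  filter_upwards [FinSubspace.eventually_mem 𝕜 a, FinSubspace.eventually_mem 𝕜 b] with V ha hb φ
  rw [V.inner_proj φ ha, V.inner_proj φ hb]

end L1Extension

/-! ### Finite sums of coherent states are cylinder states. -/

section CylinderState
variable {L : Type*} [NormedAddCommGroup L] [InnerProductSpace ℂ L]

theorem IsCylinderState.mem_stateSpace {V : FinSubspace ℂ L} {f : L → ℂ}
    (h : IsCylinderState V f) : f ∈ stateSpace L :=
  ⟨fun _ => f, fun _ => ⟨V, h⟩, fun ε hε => ⟨0, fun _ _ _ _ => ⟨V, h, h, by simpa using hε⟩⟩,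
    fun _ => tendsto_const_nhds⟩

theorem IsCylinderState.mono {V W : FinSubspace ℂ L} (hVW : V ≤ W) {f : L → ℂ}
    (h : IsCylinderState V f) : IsCylinderState W f := by
  have hVW' : V.1 ≤ W.1 := hVW
  refine ⟨fun x y hxy => h.1 x y fun v hv => hxy v (hVW' hv), h.2.1, ?_⟩
  refine (memLp_congr_ae (Eventually.of_forall fun φ => ?_)).1 h.2.2
  exact h.1 _ _ fun v hv => by rw [V.inner_proj φ hv, W.inner_proj φ (hVW' hv)]

theorem IsCylinderState.add {V W : FinSubspace ℂ L} {f g : L → ℂ}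
    (hf : IsCylinderState V f) (hg : IsCylinderState W g) :
    ∃ U : FinSubspace ℂ L, IsCylinderState U (f + g) := by
  obtain ⟨U, hVU, hWU⟩ := exists_ge_ge V W
  have hf := hf.mono hVU
  have hg := hg.mono hWU
  refine ⟨U, fun x y hxy => ?_, hf.2.1.add hg.2.1, hf.2.2.add hg.2.2⟩
  rw [Pi.add_apply, Pi.add_apply, hf.1 x y hxy, hg.1 x y hxy]

theorem IsCylinderState.const_smul {V : FinSubspace ℂ L} (a : ℂ) {f : L → ℂ}
    (hf : IsCylinderState V f) : IsCylinderState V (a • f) := by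
  refine ⟨fun x y hxy => ?_, hf.2.1.const_smul a, hf.2.2.const_smul a⟩
  rw [Pi.smul_apply, Pi.smul_apply, hf.1 x y hxy]

/-- K_ξ depends only on the projection to the line of ξ, and |K_ξ|² = exp(re⟪ξ, ·⟫) has a finite
Gaussian integral. -/
theorem isCylinderState_coherentState (ξ : L) :
    ∃ V : FinSubspace ℂ L, IsCylinderState V (coherentState ξ) := by
  let V : FinSubspace ℂ L := ⟨Submodule.span ℂ {ξ}, FiniteDimensional.span_of_finite ℂ (by simp)⟩
  have hξ : ξ ∈ V.1 := Submodule.subset_span rfl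
  refine ⟨V, fun x y hxy => ?_, ?_, ?_⟩
  · simp only [coherentState, hxy ξ hξ]
  · exact (((innerSL ℂ ξ).differentiable).const_mul _).cexp
  · have hm : Measurable fun φ : AlgDual ℂ L => coherentState ξ (V.proj φ) := by
      simp only [coherentState, V.inner_proj _ hξ]
      exact ((measurable_eval ξ).const_mul _).cexp
    rw [← memLp_norm_iff hm.aestronglyMeasurable,
      memLp_two_iff_integrable_sq hm.norm.aestronglyMeasurable]
    refine ((exp_eval (𝕜 := ℂ) (1 / 2) ξ 0).1.norm).congr (Eventually.of_forall fun φ => ?_)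
    simp only [coherentState, V.inner_proj _ hξ, Complex.norm_exp, ← Real.exp_nat_mul]
    simp

end CylinderState

/-! ### Lagrangian subspaces, their conjugations, and amplitudes of coherent states. -/

section Lagrangian
variable {L : Type*} [NormedAddCommGroup L] [InnerProductSpace ℂ L]
  {X : Type*} [AddCommGroup X] [Module ℝ X]

theorem Region.im_inner_eq_zero (M : Region L X) {x y : L} (hx : x ∈ M.solutions)
    (hy : y ∈ M.solutions) : (⟪x, y⟫_ℂ).im = 0 := by
  have h := (M.lagrangian x).1 hx y hy
  rw [symplecticForm] at h
  linarith

theorem Region.inner_eq_re (M : Region L X) {x y : L} (hx : x ∈ M.solutions)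
    (hy : y ∈ M.solutions) : ⟪x, y⟫_ℂ = ((⟪x, y⟫_ℂ).re : ℝ) :=
  Complex.ext rfl (by rw [M.im_inner_eq_zero hx hy, Complex.ofReal_im])

theorem Region.amplitude_coherentState (M : Region L X) {a b : L} (ha : a ∈ M.solutions)
    (hb : b ∈ M.solutions) :
    M.Integrable (coherentState (a + Complex.I • b)) ∧
    M.amplitude (coherentState (a + Complex.I • b)) =
      Complex.exp ((1 / 4) * ⟪a + Complex.I • b, a - Complex.I • b⟫_ℂ) := by
  let _ := realInnerProductSpace M.solutions
  have hin : ∀ x y : M.solutions, ⟪x, y⟫_ℝ = (⟪(x : L), (y : L)⟫_ℂ).re := fun _ _ => rfl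
  -- The inner product is real on a Lagrangian subspace, so ½⟪a + ib, φ⟫ = ⟪a/2, φ⟫ − i⟪b/2, φ⟫
  -- there. The variance for g/4 is 2, which produces the factor 1/4 in the result.
  have h := isL1Extension_exp ℝ (1 / 4) ((1 / 2 : ℝ) • (⟨a, ha⟩ : M.solutions))
    ((-(1 / 2) : ℝ) • (⟨b, hb⟩ : M.solutions))
  have hf : (fun φ : M.solutions => coherentState (a + Complex.I • b) (φ : L)) = fun φ =>
      Complex.exp ((RCLike.re ⟪(1 / 2 : ℝ) • (⟨a, ha⟩ : M.solutions), φ⟫_ℝ : ℝ) +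
        (RCLike.re ⟪(-(1 / 2) : ℝ) • (⟨b, hb⟩ : M.solutions), φ⟫_ℝ : ℝ) * Complex.I) := by
    ext φ
    rw [coherentState, inner_add_left, inner_smul_left, M.inner_eq_re ha φ.2,
      M.inner_eq_re hb φ.2, inner_smul_left, inner_smul_left, hin, hin]
    congr 1
    simp
    ring
  rw [← hf] at h
  refine ⟨⟨_, h⟩, ?_⟩
  refine h.gaussIntegral_eq.trans ?_
  rw [(exp_eval _ _ _).2]
  congr 1
  have hna : ⟪a, a⟫_ℂ = (‖a‖ ^ 2 : ℝ) := by
    rw [inner_self_eq_norm_sq_to_K]; simp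
  have hnb : ⟪b, b⟫_ℂ = (‖b‖ ^ 2 : ℝ) := by
    rw [inner_self_eq_norm_sq_to_K]; simp
  have hba : ⟪b, a⟫_ℂ = ((⟪a, b⟫_ℂ).re : ℝ) := by
    rw [← inner_conj_symm, M.inner_eq_re ha hb]; simp
  have e : ⟪a + Complex.I • b, a - Complex.I • b⟫_ℂ =
      (‖a‖ ^ 2 : ℝ) - (‖b‖ ^ 2 : ℝ) - 2 * Complex.I * ((⟪a, b⟫_ℂ).re : ℝ) := by
    obtain ⟨r, hr⟩ : ∃ r : ℝ, ⟪a, b⟫_ℂ = r := ⟨_, M.inner_eq_re ha hb⟩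
    simp only [inner_add_left, inner_sub_right, inner_smul_left, inner_smul_right, hna, hnb, hba,
      hr, Complex.conj_I, Complex.ofReal_re]
    linear_combination ((‖b‖ ^ 2 : ℝ) : ℂ) * Complex.I_sq
  rw [e, norm_smul, norm_smul, real_inner_smul_left, real_inner_smul_right, hin]
  have n1 : ‖(⟨a, ha⟩ : M.solutions)‖ = ‖a‖ := rfl
  have n2 : ‖(⟨b, hb⟩ : M.solutions)‖ = ‖b‖ := rfl
  rw [n1, n2]
  simp
  ring

/-- The conjugation with respect to a Lagrangian subspace: the reflection in the real subspace of
the solutions in the interior of the region. -/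
theorem Region.exists_conjugation [CompleteSpace L] (M : Region L X) :
    ∃ u : L →L[ℝ] L, (∀ x ∈ M.solutions, u x = x) ∧ (∀ x, u (Complex.I • x) = -(Complex.I • u x)) ∧
      (∀ x y, ⟪x, u y⟫_ℂ = ⟪y, u x⟫_ℂ) ∧
      ∀ x, ∃ a ∈ M.solutions, ∃ b ∈ M.solutions,
        x = a + Complex.I • b ∧ u x = a - Complex.I • b := by
  let _ : InnerProductSpace ℝ L := InnerProductSpace.complexToReal
  have : CompleteSpace M.solutions := M.isClosed_range.completeSpace_coe
  let P := M.solutions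
  let u := P.reflection
  have hre : ∀ x y : L, ⟪x, y⟫_ℝ = (⟪x, y⟫_ℂ).re := fun _ _ => rfl
  -- Up to sign, re⟪y, ix⟫ is im⟪y, x⟫. So multiplication by i maps P into its real orthogonal
  -- complement because P is isotropic, and maps the complement back into P because P is its own
  -- symplectic complement.
  have hI : ∀ x ∈ P, Complex.I • x ∈ Pᗮ := by
    intro x hx
    rw [Submodule.mem_orthogonal]
    intro y hy
    rw [hre, inner_smul_right, Complex.I_mul_re, M.im_inner_eq_zero hy hx, neg_zero]
  have hI' : ∀ x ∈ Pᗮ, Complex.I • x ∈ P := by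
    intro x hx
    rw [Submodule.mem_orthogonal] at hx
    refine (M.lagrangian _).2 fun y hy => ?_
    have h := hx y hy
    rw [hre, ← inner_conj_symm, Complex.conj_re] at h
    rw [symplecticForm, inner_smul_left]
    simp [h]
  have huP : ∀ x ∈ P, u x = x := fun x hx => P.reflection_mem_subspace_eq_self hx
  have huO : ∀ x ∈ Pᗮ, u x = -x := fun x hx =>
    P.reflection_mem_subspace_orthogonalComplement_eq_neg hx
  have hdec : ∀ x : L, ∃ a ∈ P, ∃ b ∈ P, x = a + Complex.I • b ∧ u x = a - Complex.I • b := by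
    intro x
    obtain ⟨a, ha, w, hw, hx⟩ := P.exists_add_mem_mem_orthogonal x
    refine ⟨a, ha, -(Complex.I • w), P.neg_mem (hI' w hw), ?_, ?_⟩
    · rw [smul_neg, smul_smul, Complex.I_mul_I, neg_one_smul, neg_neg, hx]
    · rw [smul_neg, smul_smul, Complex.I_mul_I, neg_one_smul, neg_neg, hx, map_add, huP a ha,
        huO w hw, sub_eq_add_neg]
  have hanti : ∀ x, u (Complex.I • x) = -(Complex.I • u x) := by
    intro x
    obtain ⟨a, ha, b, hb, hx, hux⟩ := hdec x
    rw [hux, hx, smul_add, smul_sub, smul_smul, Complex.I_mul_I, neg_one_smul, map_add, map_neg,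
      huP b hb, huO _ (hI a ha)]
    abel
  have hsym : ∀ x y, ⟪x, u y⟫_ℝ = ⟪y, u x⟫_ℝ := by
    intro x y
    rw [← u.inner_map_map x (u y), P.reflection_reflection, real_inner_comm]
  refine ⟨u.toContinuousLinearEquiv, huP, hanti, fun x y => ?_, hdec⟩
  change ⟪x, u y⟫_ℂ = ⟪y, u x⟫_ℂ
  refine Complex.ext (hsym x y) ?_
  -- The imaginary parts agree by the real symmetry for ix, since u anticommutes with i.
  have h := hsym (Complex.I • x) y
  rw [hanti, inner_neg_right, hre, hre, inner_smul_left, inner_smul_right] at h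
  simpa using h

end Lagrangian

/-! ### Holomorphic dependence of exponential integrals on a parameter. -/

section Entire
variable {Ω : Type*} [MeasurableSpace Ω] {μ : Measure Ω} {G : Ω → ℂ} {x y : Ω → ℝ}

/-- According to the signs of x and y, exp(r(|x| + |y|)) equals one of the four exponentials exp(±rx
± ry), hence is at most their sum. -/
theorem integrable_exp_abs (hG : AEStronglyMeasurable G μ) (hx : Measurable x) (hy : Measurable y)
    (h : ∀ s t : ℝ, Integrable (fun ω => ‖G ω‖ * Real.exp (s * x ω + t * y ω)) μ) (r : ℝ) :
    Integrable (fun ω => ‖G ω‖ * Real.exp (r * (|x ω| + |y ω|))) μ := by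
  refine Integrable.mono' (((h r r).add (h r (-r))).add ((h (-r) r).add (h (-r) (-r))))
    (hG.norm.mul (by fun_prop)) (Eventually.of_forall fun ω => ?_)
  simp only [Pi.add_apply]
  rw [norm_mul, norm_norm, Real.norm_of_nonneg (Real.exp_pos _).le]
  refine le_of_le_of_eq (mul_le_mul_of_nonneg_left (c := Real.exp (r * x ω + r * y ω) +
    Real.exp (r * x ω + -r * y ω) + (Real.exp (-r * x ω + r * y ω) +
    Real.exp (-r * x ω + -r * y ω))) ?_ (norm_nonneg (G ω))) (by rw [mul_add, mul_add, mul_add])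
  have p1 := Real.exp_pos (r * x ω + r * y ω)
  have p2 := Real.exp_pos (r * x ω + -r * y ω)
  have p3 := Real.exp_pos (-r * x ω + r * y ω)
  have p4 := Real.exp_pos (-r * x ω + -r * y ω)
  have key : Real.exp (r * (|x ω| + |y ω|)) = Real.exp (r * x ω + r * y ω) ∨
      Real.exp (r * (|x ω| + |y ω|)) = Real.exp (r * x ω + -r * y ω) ∨
      Real.exp (r * (|x ω| + |y ω|)) = Real.exp (-r * x ω + r * y ω) ∨
      Real.exp (r * (|x ω| + |y ω|)) = Real.exp (-r * x ω + -r * y ω) := by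
    rcases abs_choice (x ω) with h1 | h1 <;> rcases abs_choice (y ω) with h2 | h2 <;> rw [h1, h2]
    · left; ring_nf
    · right; left; ring_nf
    · right; right; left; ring_nf
    · right; right; right; ring_nf
  rcases key with h | h | h | h <;> rw [h] <;> linarith

theorem differentiable_integral_exp (hG : AEStronglyMeasurable G μ) (hx : Measurable x)
    (hy : Measurable y)
    (h : ∀ s t : ℝ, Integrable (fun ω => ‖G ω‖ * Real.exp (s * x ω + t * y ω)) μ) :
    Differentiable ℂ fun w : ℂ => ∫ ω, G ω * Complex.exp (w * (x ω + y ω * Complex.I)) ∂μ := by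
  intro w₀
  have hb : ∀ w ω, ‖Complex.exp (w * (x ω + y ω * Complex.I))‖ ≤
      Real.exp (‖w‖ * (|x ω| + |y ω|)) := by
    intro w ω
    refine (Complex.norm_exp_le_exp_norm _).trans (Real.exp_le_exp.2 ?_)
    rw [norm_mul]
    refine mul_le_mul_of_nonneg_left ((norm_add_le _ _).trans ?_) (norm_nonneg _)
    simp
  have hmeas : ∀ w : ℂ, Measurable fun ω => Complex.exp (w * (x ω + y ω * Complex.I)) := by
    intro w
    fun_prop
  -- In the bound ‖w₀‖ + 2, one unit is the radius of the ball around w₀, and the other absorbs the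
  -- factor x + iy of the derivative through |x| + |y| ≤ exp(|x| + |y|).
  refine (hasDerivAt_integral_of_dominated_loc_of_deriv_le (Metric.ball_mem_nhds w₀ one_pos)
    (F' := fun w ω => G ω * (Complex.exp (w * (x ω + y ω * Complex.I)) *
      (x ω + y ω * Complex.I)))
    (bound := fun ω => ‖G ω‖ * Real.exp ((‖w₀‖ + 2) * (|x ω| + |y ω|)))
    (Eventually.of_forall fun w => hG.mul (hmeas w).aestronglyMeasurable) ?_
    (hG.mul (Measurable.aestronglyMeasurable (by fun_prop))) ?_
    (integrable_exp_abs hG hx hy h _) ?_).2.differentiableAt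
  · refine (integrable_exp_abs hG hx hy h ‖w₀‖).mono' (hG.mul (hmeas _).aestronglyMeasurable)
      (Eventually.of_forall fun ω => ?_)
    rw [Pi.mul_apply, norm_mul]
    exact mul_le_mul_of_nonneg_left (hb _ _) (norm_nonneg _)
  · refine Eventually.of_forall fun ω w hw => ?_
    rw [norm_mul, norm_mul]
    refine mul_le_mul_of_nonneg_left ?_ (norm_nonneg _)
    have hm : 0 ≤ |x ω| + |y ω| := by positivity
    have h1 : ‖(x ω + y ω * Complex.I : ℂ)‖ ≤ Real.exp (|x ω| + |y ω|) := by
      refine ((norm_add_le _ _).trans (le_of_eq ?_)).trans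
        ((le_add_of_nonneg_right zero_le_one).trans (Real.add_one_le_exp _))
      simp
    have hw' : ‖w‖ ≤ ‖w₀‖ + 1 := by
      have h2 := norm_sub_norm_le w w₀
      rw [mem_ball_iff_norm] at hw
      linarith
    calc _ ≤ Real.exp (‖w‖ * (|x ω| + |y ω|)) * Real.exp (|x ω| + |y ω|) :=
          mul_le_mul (hb _ _) h1 (norm_nonneg _) (Real.exp_pos _).le
      _ ≤ _ := by
          rw [← Real.exp_add]
          refine Real.exp_le_exp.2 ?_
          nlinarith
  · refine Eventually.of_forall fun ω w _ => ?_
    simpa using (((hasDerivAt_id w).mul_const (x ω + y ω * Complex.I : ℂ)).cexp.const_mul (G ω))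

theorem eq_of_eq_on_reals {f g : ℂ → ℂ} (hf : Differentiable ℂ f) (hg : Differentiable ℂ g)
    (h : ∀ t : ℝ, f t = g t) : f = g := by
  refine AnalyticOnNhd.eq_of_frequently_eq (z₀ := 0)
    (fun z _ => hf.analyticAt z) (fun z _ => hg.analyticAt z) ?_
  have h1 : Tendsto (fun t : ℝ => (t : ℂ)) (𝓝[≠] 0) (𝓝[≠] 0) := by
    refine tendsto_nhdsWithin_iff.2 ⟨?_, ?_⟩
    · have := (Complex.continuous_ofReal.tendsto 0).mono_left (nhdsWithin_le_nhds (s := {0}ᶜ))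
      simpa using this
    · filter_upwards [self_mem_nhdsWithin] with t ht
      simpa using ht
  exact h1.frequently (Eventually.of_forall h).frequently

end Entire

/-! ### Translation of the measure with density |exp(B/4)|. -/

section Shift
variable {E : Type*} [NormedAddCommGroup E] [InnerProductSpace ℂ E]

/-- The real bilinear form `re ⟪x, y⟫ - re (B x y) / 2`. -/
def covarianceForm (B : E →ₗ[ℝ] E →ₗ[ℝ] ℂ) : E →ₗ[ℝ] E →ₗ[ℝ] ℝ :=
  LinearMap.mk₂ ℝ (fun x y => (⟪x, y⟫_ℂ).re - (B x y).re / 2)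
    (fun x x' y => by simp only [inner_add_left, map_add, LinearMap.add_apply, Complex.add_re]; ring)
    (fun r x y => by
      simp only [map_smul, LinearMap.smul_apply, Complex.real_smul, Complex.re_ofReal_mul,
        smul_eq_mul, inner_smul_left_eq_smul]
      ring)
    (fun x y y' => by simp only [inner_add_right, map_add, Complex.add_re]; ring)
    (fun r x y => by
      simp only [map_smul, Complex.real_smul, Complex.re_ofReal_mul, smul_eq_mul,
        inner_smul_right_eq_smul]
      ring)

theorem covarianceForm_apply (B : E →ₗ[ℝ] E →ₗ[ℝ] ℂ) (x y : E) :
    covarianceForm B x y = (⟪x, y⟫_ℂ).re - (B x y).re / 2 := rfl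

/-- The exponential of a quadratic form. -/
def quadExp (B : E →ₗ[ℝ] E →ₗ[ℝ] ℂ) (x : E) : ℂ := Complex.exp ((1 / 4) * B x x)

theorem norm_quadExp (B : E →ₗ[ℝ] E →ₗ[ℝ] ℂ) (x : E) :
    ‖quadExp B x‖ = Real.exp ((B x x).re / 4) := by
  rw [quadExp, Complex.norm_exp]
  congr 1
  have : (1 / 4 : ℂ) = ((1 / 4 : ℝ) : ℂ) := by norm_num
  rw [this, Complex.re_ofReal_mul]
  ring

theorem continuous_quadExp {B : E →ₗ[ℝ] E →ₗ[ℝ] ℂ} (hcont : Continuous fun x => B x x) :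
    Continuous (quadExp B) := (continuous_const.mul hcont).cexp

/-- On V the measure with density `‖quadExp B‖` has Lebesgue density proportional to exp(−Q(x,
x)/2), where Q is `covarianceForm B`; thus Q is its inverse covariance. Its Cameron–Martin weight is
therefore that of the standard Gaussian with Q in place of the real inner product. -/
theorem quadExp_shift {B : E →ₗ[ℝ] E →ₗ[ℝ] ℂ} (hsym : ∀ x y, B x y = B y x)
    (hcont : Continuous fun x => B x x) (V : FinSubspace ℂ E) {s : E} (hs : s ∈ V.1) {h : E → ℂ}
    (hh : Continuous h) :
    (Integrable (fun φ => (‖quadExp B (V.proj φ)‖ * Real.exp (-covarianceForm B (V.proj φ) s -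
      covarianceForm B s s / 2) : ℝ) * h (V.proj φ + s)) (gaussianMeasure ℂ E (1 / 2)) ↔
      Integrable (fun φ => (‖quadExp B (V.proj φ)‖ : ℂ) * h (V.proj φ))
        (gaussianMeasure ℂ E (1 / 2))) ∧
    ∫ φ, (‖quadExp B (V.proj φ)‖ * Real.exp (-covarianceForm B (V.proj φ) s -
      covarianceForm B s s / 2) : ℝ) * h (V.proj φ + s) ∂(gaussianMeasure ℂ E (1 / 2)) =
      ∫ φ, (‖quadExp B (V.proj φ)‖ : ℂ) * h (V.proj φ) ∂(gaussianMeasure ℂ E (1 / 2)) := by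
  have hc : Continuous fun x => (‖quadExp B x‖ : ℂ) * h x :=
    (Complex.continuous_ofReal.comp (continuous_quadExp hcont).norm).mul hh
  have e : ∀ φ : AlgDual ℂ E, (Real.exp (-RCLike.re (φ s) - ‖s‖ ^ 2 / 2) : ℂ) *
      ((‖quadExp B (V.proj φ + s)‖ : ℂ) * h (V.proj φ + s)) =
      (‖quadExp B (V.proj φ)‖ * Real.exp (-covarianceForm B (V.proj φ) s -
      covarianceForm B s s / 2) : ℝ) * h (V.proj φ + s) := by
    intro φ
    rw [← mul_assoc, ← Complex.ofReal_mul]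
    congr 2
    rw [norm_quadExp, norm_quadExp, ← Real.exp_add, ← Real.exp_add, covarianceForm_apply,
      covarianceForm_apply, ← V.inner_proj φ hs, ← inner_conj_symm, RCLike.conj_re]
    congr 1
    have hn : (⟪s, s⟫_ℂ).re = ‖s‖ ^ 2 := by
      rw [inner_self_eq_norm_sq_to_K]
      norm_cast
    simp only [map_add, LinearMap.add_apply, hsym s, Complex.add_re, hn]
    change -(⟪V.proj φ, s⟫_ℂ).re - _ + _ = _
    ring
  have h1 := V.cameronMartin hs hc
  simp_rw [e] at h1
  exact h1

end Shift

/-! ### Integrability forces a nondegenerate Gaussian on each finite dimensional subspace. -/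

section Nondegenerate
variable {E : Type*} [NormedAddCommGroup E] [InnerProductSpace ℂ E]
  {B : E →ₗ[ℝ] E →ₗ[ℝ] ℂ}

theorem integral_norm_quadExp_pos {V : FinSubspace ℂ E}
    (hV : Integrable (fun φ => quadExp B (V.proj φ)) (gaussianMeasure ℂ E (1 / 2))) :
    0 < ∫ φ, ‖quadExp B (V.proj φ)‖ ∂(gaussianMeasure ℂ E (1 / 2)) := by
  have h := hV.norm
  simp only [norm_quadExp] at h ⊢
  exact integral_exp_pos h

/-- Along a degenerate direction s the finite measure `‖quadExp B‖` ν is translation invariant. The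
Fourier transform χ of its coordinate along s then vanishes away from 0, while it is continuous and
at 0 equals the positive total mass. -/
theorem eq_zero_of_covarianceForm_eq_zero (hsym : ∀ x y, B x y = B y x)
    (hcont : Continuous fun x => B x x) {V : FinSubspace ℂ E}
    (hV : Integrable (fun φ => quadExp B (V.proj φ)) (gaussianMeasure ℂ E (1 / 2)))
    {s : E} (hs : s ∈ V.1) (h0 : ∀ x ∈ V.1, covarianceForm B x s = 0) : s = 0 := by
  by_contra hne
  set ν := gaussianMeasure ℂ E (1 / 2)
  set χ : ℝ → ℂ := fun t => ∫ φ, (‖quadExp B (V.proj φ)‖ : ℂ) *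
    Complex.exp ((t * (⟪s, V.proj φ⟫_ℂ).re : ℝ) * Complex.I) ∂ν with hχ
  have hsn : ‖s‖ ^ 2 ≠ 0 := by positivity
  have hm : ∀ t : ℝ, AEStronglyMeasurable (fun φ => (‖quadExp B (V.proj φ)‖ : ℂ) *
    Complex.exp ((t * (⟪s, V.proj φ⟫_ℂ).re : ℝ) * Complex.I)) ν := by
    intro t
    refine hV.norm.ofReal.aestronglyMeasurable.mul (Measurable.aestronglyMeasurable ?_)
    simp only [V.inner_proj _ hs]
    have := measurable_re_eval (𝕜 := ℂ) s
    exact ((Complex.measurable_ofReal.comp (this.const_mul t)).mul_const _).cexp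
  have hχc : Continuous χ := by
    refine continuous_of_dominated hm (bound := fun φ => ‖quadExp B (V.proj φ)‖)
      (fun t => Eventually.of_forall fun φ => ?_) hV.norm (Eventually.of_forall fun φ => ?_)
    · rw [norm_mul, Complex.norm_exp_ofReal_mul_I, mul_one, Complex.norm_real, norm_norm]
    · fun_prop
  have hχ0 : ∀ t ∈ ({0}ᶜ : Set ℝ), χ t = 0 := by
    intro t ht
    have ht' : t ≠ 0 := ht
    -- Translation by r • s shifts the phase t⟪s, ·⟫ by π, so χ(t) = −χ(t).
    set r : ℝ := Real.pi / (t * ‖s‖ ^ 2) with hr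
    have hrs : r • s ∈ V.1 := by
      rw [← Complex.coe_smul]
      exact V.1.smul_mem _ hs
    have hsh := (quadExp_shift hsym hcont V hrs
      (h := fun x => Complex.exp ((t * (⟪s, x⟫_ℂ).re : ℝ) * Complex.I)) (by fun_prop)).2
    have e : ∀ φ : AlgDual ℂ E, (‖quadExp B (V.proj φ)‖ * Real.exp (-covarianceForm B (V.proj φ)
        (r • s) - covarianceForm B (r • s) (r • s) / 2) : ℝ) *
        Complex.exp ((t * (⟪s, V.proj φ + r • s⟫_ℂ).re : ℝ) * Complex.I) =
        -((‖quadExp B (V.proj φ)‖ : ℂ) *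
          Complex.exp ((t * (⟪s, V.proj φ⟫_ℂ).re : ℝ) * Complex.I)) := by
      intro φ
      rw [map_smul, h0 _ (V.proj_mem φ), map_smul, h0 _ hrs]
      have h1 : (t * (⟪s, V.proj φ + r • s⟫_ℂ).re : ℝ) =
          t * (⟪s, V.proj φ⟫_ℂ).re + Real.pi := by
        have hn : (⟪s, s⟫_ℂ).re = ‖s‖ ^ 2 := by
          rw [inner_self_eq_norm_sq_to_K]
          norm_cast
        rw [inner_add_right, inner_smul_right_eq_smul, Complex.add_re, Complex.real_smul,
          Complex.re_ofReal_mul, hn, hr]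
        field_simp
      rw [h1]
      push_cast
      rw [add_mul, Complex.exp_add, Complex.exp_pi_mul_I]
      simp
    simp_rw [e] at hsh
    rw [integral_neg] at hsh
    have h2 : -χ t = χ t := hsh
    linear_combination (-1 / 2 : ℂ) * h2
  have h3 := congrFun (hχc.ext_on (dense_compl_singleton 0) (continuous_const (y := (0 : ℂ))) hχ0) 0
  have h4 : χ 0 = ((∫ φ, ‖quadExp B (V.proj φ)‖ ∂ν : ℝ) : ℂ) := by
    rw [hχ, ← integral_complex_ofReal]
    simp
  rw [h4] at h3
  exact (integral_norm_quadExp_pos hV).ne' (by exact_mod_cast h3)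

/-- Nondegeneracy makes V → V* injective, hence surjective in finite dimension. The solution s is
the translation that produces the exponential of the coordinate of a. -/
theorem exists_covarianceForm_eq (hsym : ∀ x y, B x y = B y x)
    (hcont : Continuous fun x => B x x) {V : FinSubspace ℂ E}
    (hV : Integrable (fun φ => quadExp B (V.proj φ)) (gaussianMeasure ℂ E (1 / 2))) (a : E) :
    ∃ s ∈ V.1, ∀ x ∈ V.1, covarianceForm B x s = (⟪a, x⟫_ℂ).re := by
  let W : Submodule ℝ E := V.1.restrictScalars ℝ
  have := V.2
  have : FiniteDimensional ℝ W := FiniteDimensional.trans ℝ ℂ V.1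
  let T : W →ₗ[ℝ] Module.Dual ℝ W :=
    (LinearMap.lcomp ℝ ℝ W.subtype) ∘ₗ (covarianceForm B).flip ∘ₗ W.subtype
  have hT : ∀ s x : W, T s x = covarianceForm B x s := fun _ _ => rfl
  have hinj : Function.Injective T := by
    refine (injective_iff_map_eq_zero T).2 fun s hs => ?_
    refine Subtype.ext (eq_zero_of_covarianceForm_eq_zero hsym hcont hV s.2 fun x hx => ?_)
    have := DFunLike.congr_fun hs (⟨x, hx⟩ : W)
    rwa [hT] at this
  have hsurj := (LinearMap.injective_iff_surjective_of_finrank_eq_finrank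
    (Subspace.dual_finrank_eq (K := ℝ) (V := W)).symm).1 hinj
  -- For B = 0 the form is the real inner product.
  obtain ⟨s, hs⟩ := hsurj ((covarianceForm 0 a) ∘ₗ W.subtype)
  refine ⟨s, s.2, fun x hx => ?_⟩
  have := DFunLike.congr_fun hs (⟨x, hx⟩ : W)
  rw [hT] at this
  rw [this]
  simp [covarianceForm_apply]

/-- Under the measure with density `‖quadExp B‖`, the real coordinates are centered Gaussians. -/
theorem exists_mgf_quadExp (hsym : ∀ x y, B x y = B y x)
    (hcont : Continuous fun x => B x x) {V : FinSubspace ℂ E}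
    (hV : Integrable (fun φ => quadExp B (V.proj φ)) (gaussianMeasure ℂ E (1 / 2)))
    {a : E} (ha : a ∈ V.1) :
    ∃ κ : ℝ, (∀ t : ℝ, Integrable (fun φ => ‖quadExp B (V.proj φ)‖ *
      Real.exp (t * RCLike.re (φ a))) (gaussianMeasure ℂ E (1 / 2))) ∧
    ∀ z : ℂ, ∫ φ, (‖quadExp B (V.proj φ)‖ : ℂ) * Complex.exp (z * (RCLike.re (φ a) : ℝ))
      ∂(gaussianMeasure ℂ E (1 / 2)) =
      (∫ φ, ‖quadExp B (V.proj φ)‖ ∂(gaussianMeasure ℂ E (1 / 2)) : ℝ) *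
        Complex.exp (κ * z ^ 2 / 2) := by
  set ν := gaussianMeasure ℂ E (1 / 2)
  obtain ⟨s, hs, hsa⟩ := exists_covarianceForm_eq hsym hcont hV a
  set κ := covarianceForm B s s with hκ
  have key : ∀ t : ℝ, Integrable (fun φ => ‖quadExp B (V.proj φ)‖ *
      Real.exp (t * RCLike.re (φ a))) ν ∧ ∫ φ, ‖quadExp B (V.proj φ)‖ *
      Real.exp (t * RCLike.re (φ a)) ∂ν = (∫ φ, ‖quadExp B (V.proj φ)‖ ∂ν) *
        Real.exp (κ * t ^ 2 / 2) := by
    -- Translation by −ts has the weight exp(t re φ(a) − κt²/2), so its total mass gives the moment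
    -- generating function; κ is the variance of the coordinate.
    intro t
    have hts : (-t) • s ∈ V.1 := by
      rw [← Complex.coe_smul]
      exact V.1.smul_mem _ hs
    have hsh := quadExp_shift hsym hcont V hts (h := fun _ => 1) continuous_const
    have e : ∀ φ : AlgDual ℂ E, ((‖quadExp B (V.proj φ)‖ * Real.exp (-covarianceForm B (V.proj φ)
        ((-t) • s) - covarianceForm B ((-t) • s) ((-t) • s) / 2) : ℝ) : ℂ) * 1 =
        ((Real.exp (-(κ * t ^ 2 / 2)) * (‖quadExp B (V.proj φ)‖ *
          Real.exp (t * RCLike.re (φ a))) : ℝ) : ℂ) := by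
      intro φ
      rw [mul_one]
      congr 1
      rw [mul_left_comm, ← Real.exp_add, map_smul, map_smul, map_smul, LinearMap.smul_apply,
        ← hκ, hsa _ (V.proj_mem φ), V.inner_proj φ ha]
      congr 2
      simp only [smul_eq_mul, RCLike.re_eq_complex_re]
      ring
    simp_rw [e] at hsh
    simp only [mul_one] at hsh
    obtain ⟨h1, h2⟩ := hsh
    have h3 := (h1.2 hV.norm.ofReal).re
    simp only [RCLike.re_eq_complex_re, Complex.ofReal_re] at h3
    rw [integral_complex_ofReal, integral_complex_ofReal, integral_const_mul] at h2
    refine ⟨(integrable_const_mul_iff (Real.exp_pos _).ne'.isUnit _).1 h3, ?_⟩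
    rw [← Complex.ofReal_inj.1 h2, mul_right_comm, ← Real.exp_add,
      neg_add_cancel, Real.exp_zero, one_mul]
  refine ⟨κ, fun t => (key t).1, fun z => ?_⟩
  -- Both sides are entire in z and agree for real z. Imaginary z then gives the Fourier transform.
  have hd := differentiable_integral_exp (μ := ν) (G := fun φ => (‖quadExp B (V.proj φ)‖ : ℂ))
    (x := fun φ => RCLike.re (φ a)) (y := fun _ => 0) hV.norm.ofReal.aestronglyMeasurable
    (measurable_re_eval a) measurable_const
    (fun t r => by simpa using (key t).1)
  have heq := congrFun (eq_of_eq_on_reals hd (g := fun z =>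
    (∫ φ, ‖quadExp B (V.proj φ)‖ ∂ν : ℝ) * Complex.exp (κ * z ^ 2 / 2)) (by fun_prop) ?_) z
  · simpa using heq
  · intro t
    have h := congrArg (fun r : ℝ => (r : ℂ)) (key t).2
    simp only [← integral_complex_ofReal] at h
    push_cast at h ⊢
    simpa [integral_complex_ofReal] using h

end Nondegenerate

/-! ### Bounded exponential moments and multiplication by linear exponentials. -/

section ExpMoments
variable {𝕜 : Type*} [RCLike 𝕜] {E : Type*} [NormedAddCommGroup E] [InnerProductSpace 𝕜 E]
  {c : ℝ≥0} {f : E → ℂ} {F : AlgDual 𝕜 E → ℂ}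

variable (𝕜) in
/-- The exponential moments of the cylinder functions of `f` are eventually bounded. -/
def HasExpMoments (c : ℝ≥0) (f : E → ℂ) : Prop :=
  ∀ a : E, ∃ C : ℝ, ∀ᶠ V : FinSubspace 𝕜 E in atTop,
    Integrable (fun φ => ‖f (V.proj φ)‖ * Real.exp (RCLike.re (φ a))) (gaussianMeasure 𝕜 E c) ∧
    ∫ φ, ‖f (V.proj φ)‖ * Real.exp (RCLike.re (φ a)) ∂(gaussianMeasure 𝕜 E c) ≤ C

/-- The uniform bound passes to the limit on each set where re φ(a) ≤ n, since the exponential is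
bounded there. The resulting bound C does not depend on n, and these sets exhaust the space. -/
theorem HasExpMoments.integrable_norm_mul_exp (hf : HasExpMoments 𝕜 c f)
    (h : IsL1Extension 𝕜 c f F) (a : E) :
    Integrable (fun φ => ‖F φ‖ * Real.exp (RCLike.re (φ a))) (gaussianMeasure 𝕜 E c) := by
  obtain ⟨C, hC⟩ := hf a
  set ν := gaussianMeasure 𝕜 E c
  have hFm : AEStronglyMeasurable (fun φ => ‖F φ‖ * Real.exp (RCLike.re (φ a))) ν :=
    h.1.norm.aestronglyMeasurable.mul (measurable_re_eval a).exp.aestronglyMeasurable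
  let A : ℕ → Set (AlgDual 𝕜 E) := fun n => {φ | RCLike.re (φ a) ≤ n}
  have hA : ∀ n, MeasurableSet (A n) := fun n => measurableSet_le (measurable_re_eval a) measurable_const
  have hcov : AECover ν atTop A := by
    refine ⟨Eventually.of_forall fun φ => ?_, hA⟩
    filter_upwards [tendsto_natCast_atTop_atTop.eventually_ge_atTop (RCLike.re (φ a))] with n hn
    exact hn
  -- The factor exp(−n) makes the truncated exponential a test function bounded by 1; it cancels at
  -- the end.
  let b : ℕ → AlgDual 𝕜 E → ℝ := fun n =>
    (A n).indicator fun φ => Real.exp (RCLike.re (φ a)) * Real.exp (-n)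
  have hbm : ∀ n, Measurable (b n) := fun n =>
    ((measurable_re_eval a).exp.mul_const _).indicator (hA n)
  have hb0 : ∀ n φ, 0 ≤ b n φ := fun n φ =>
    Set.indicator_nonneg (fun φ _ => (mul_pos (Real.exp_pos _) (Real.exp_pos _)).le) φ
  have hb1 : ∀ n φ, b n φ ≤ 1 := by
    intro n φ
    refine Set.indicator_apply_le' (fun hφ => ?_) fun _ => zero_le_one
    have hφ' : RCLike.re (φ a) ≤ n := hφ
    rw [← Real.exp_add]
    exact Real.exp_le_one_iff.2 (by linarith)
  have hble : ∀ n φ, b n φ ≤ Real.exp (RCLike.re (φ a)) * Real.exp (-n) := fun n φ =>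
    Set.indicator_apply_le' (fun _ => le_rfl) fun _ => by positivity
  have hlim : ∀ n, ∫ φ, ‖F φ‖ * b n φ ∂ν ≤ C * Real.exp (-n) := by
    intro n
    have ht := h.norm.tendsto_integral_mul (B := fun φ => (b n φ : ℂ))
      (Complex.measurable_ofReal.comp (hbm n)) (fun φ => by
        rw [Complex.norm_real, Real.norm_of_nonneg (hb0 n φ)]
        exact hb1 n φ)
    have ht' := (Complex.continuous_re.tendsto _).comp ht
    simp only [Function.comp_def, ← Complex.ofReal_mul, integral_complex_ofReal,
      Complex.ofReal_re] at ht'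
    refine le_of_tendsto ht' ?_
    filter_upwards [hC] with V hV
    rw [mul_comm C]
    refine le_trans (integral_mono_of_nonneg (Eventually.of_forall fun φ => ?_)
      (hV.1.const_mul (Real.exp (-n))) (Eventually.of_forall fun φ => ?_))
      ((integral_const_mul _ _).trans_le (mul_le_mul_of_nonneg_left hV.2 (Real.exp_pos _).le))
    · exact mul_nonneg (norm_nonneg _) (hb0 n φ)
    · simp only
      rw [mul_left_comm, mul_comm (Real.exp (-n))]
      exact mul_le_mul_of_nonneg_left (hble n φ) (norm_nonneg _)
  have hind : ∀ n φ, ‖F φ‖ * b n φ = (A n).indicator (fun φ => Real.exp (-n) *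
      (‖F φ‖ * Real.exp (RCLike.re (φ a)))) φ := by
    intro n φ
    by_cases hφ : φ ∈ A n
    · rw [Set.indicator_of_mem hφ]
      change _ * (A n).indicator _ φ = _
      rw [Set.indicator_of_mem hφ]
      ring
    · rw [Set.indicator_of_notMem hφ]
      change _ * (A n).indicator _ φ = _
      rw [Set.indicator_of_notMem hφ, mul_zero]
  refine hcov.integrable_of_integral_norm_bounded C (fun n => ?_) (Eventually.of_forall fun n => ?_)
  · refine Integrable.mono' (h.1.norm.mul_const (Real.exp n)).integrableOn hFm.restrict ?_
    filter_upwards [ae_restrict_mem (hA n)] with φ hφ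
    rw [Real.norm_of_nonneg (by positivity)]
    exact mul_le_mul_of_nonneg_left (Real.exp_le_exp.2 hφ) (norm_nonneg _)
  · have h1 := hlim n
    simp_rw [hind] at h1
    rw [integral_indicator (hA n), integral_const_mul, mul_comm] at h1
    refine le_of_eq_of_le (integral_congr_ae (Eventually.of_forall fun φ => ?_))
      (le_of_mul_le_mul_right h1 (Real.exp_pos _))
    exact Real.norm_of_nonneg (by positivity)

/-- With y = exp(re φ(a)), the inequality y ≤ K + y²/K bounds the new L¹-distance by K times the old
one plus 1/K times the exponential moments at 2a, which are eventually bounded. K is fixed before V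
is enlarged. -/
theorem HasExpMoments.isL1Extension_mul_exp (hf : HasExpMoments 𝕜 c f)
    (h : IsL1Extension 𝕜 c f F) (a b : E) :
    IsL1Extension 𝕜 c
      (fun x => f x * Complex.exp ((RCLike.re ⟪a, x⟫_𝕜 : ℝ) + (RCLike.re ⟪b, x⟫_𝕜 : ℝ) * Complex.I))
      (fun φ => F φ * Complex.exp ((RCLike.re (φ a) : ℝ) + (RCLike.re (φ b) : ℝ) * Complex.I)) := by
  set ν := gaussianMeasure 𝕜 E c
  set e : AlgDual 𝕜 E → ℂ := fun φ =>
    Complex.exp ((RCLike.re (φ a) : ℝ) + (RCLike.re (φ b) : ℝ) * Complex.I) with he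
  have hem : Measurable e := by
    have h1 := measurable_re_eval (𝕜 := 𝕜) a
    have h2 := measurable_re_eval (𝕜 := 𝕜) b
    fun_prop
  have hen : ∀ φ, ‖e φ‖ = Real.exp (RCLike.re (φ a)) := by
    intro φ
    simp [he, Complex.norm_exp]
  have hF := hf.integrable_norm_mul_exp h
  have hev : ∀ᶠ V : FinSubspace 𝕜 E in atTop, ∀ φ : AlgDual 𝕜 E,
      Complex.exp ((RCLike.re ⟪a, V.proj φ⟫_𝕜 : ℝ) + (RCLike.re ⟪b, V.proj φ⟫_𝕜 : ℝ) * Complex.I) =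
        e φ := by
    filter_upwards [FinSubspace.eventually_mem 𝕜 a, FinSubspace.eventually_mem 𝕜 b] with V ha hb φ
    rw [V.inner_proj φ ha, V.inner_proj φ hb]
  have hint : ∀ {H : AlgDual 𝕜 E → ℂ}, AEStronglyMeasurable H ν →
      Integrable (fun φ => ‖H φ‖ * Real.exp (RCLike.re (φ a))) ν →
      Integrable (fun φ => H φ * e φ) ν := by
    intro H hH hi
    refine hi.mono' (hH.mul hem.aestronglyMeasurable) (Eventually.of_forall fun φ => ?_)
    rw [norm_mul, hen]
  obtain ⟨C₁, h₁⟩ := hf a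
  obtain ⟨C₂, h₂⟩ := hf (a + a)
  refine ⟨hint h.1.aestronglyMeasurable (hF a), ?_, ?_⟩
  · filter_upwards [hev, h.2.1, h₁] with V h1 h2 h3
    simp_rw [h1]
    exact hint h2.aestronglyMeasurable h3.1
  set D : ℝ := C₂ + ∫ φ, ‖F φ‖ * Real.exp (RCLike.re (φ (a + a))) ∂ν with hD
  have htwo : ∀ φ : AlgDual 𝕜 E,
      Real.exp (RCLike.re (φ (a + a))) = Real.exp (RCLike.re (φ a)) ^ 2 := by
    intro φ
    rw [map_add, map_add, Real.exp_add, sq]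
  rw [Metric.tendsto_nhds]
  intro ε hε
  -- D eventually bounds the moments at 2a of the cylinder function and of F together. The absolute
  -- value avoids any discussion of the sign of C₂.
  obtain ⟨K, hK0, hK⟩ : ∃ K : ℝ, 0 < K ∧ |D| / K < ε / 2 := by
    refine ⟨2 * (|D| + 1) / ε, by positivity, ?_⟩
    rw [div_div_eq_mul_div, div_lt_iff₀ (by positivity)]
    nlinarith [abs_nonneg D]
  have hsmall := h.2.2.eventually_lt_const (show (0 : ℝ) < ε / 2 / K by positivity)
  filter_upwards [hev, h.2.1, h₂, hsmall] with V h1 h2 h3 h4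
  rw [Real.dist_eq, sub_zero, abs_of_nonneg (integral_nonneg fun _ => norm_nonneg _)]
  simp_rw [h1]
  have hi1 : Integrable (fun φ => K * ‖f (V.proj φ) - F φ‖) ν := (h2.sub h.1).norm.const_mul K
  have hi2 : Integrable (fun φ => (‖f (V.proj φ)‖ * Real.exp (RCLike.re (φ (a + a))) +
      ‖F φ‖ * Real.exp (RCLike.re (φ (a + a)))) / K) ν :=
    (h3.1.add (hF (a + a))).div_const K
  have hle : ∫ φ, ‖f (V.proj φ) * e φ - F φ * e φ‖ ∂ν ≤ ∫ φ, (K * ‖f (V.proj φ) - F φ‖ +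
      (‖f (V.proj φ)‖ * Real.exp (RCLike.re (φ (a + a))) +
      ‖F φ‖ * Real.exp (RCLike.re (φ (a + a)))) / K) ∂ν := by
    refine integral_mono_of_nonneg (Eventually.of_forall fun _ => norm_nonneg _) (hi1.add hi2)
      (Eventually.of_forall fun φ => ?_)
    simp only
    rw [← sub_mul, norm_mul, hen, htwo, ← add_mul]
    set y := Real.exp (RCLike.re (φ a))
    have hy : 0 < y := Real.exp_pos _
    have hyK : y ≤ K + y ^ 2 / K := by
      rw [← sub_le_iff_le_add', le_div_iff₀ hK0]
      nlinarith [sq_nonneg (y - K)]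
    calc ‖f (V.proj φ) - F φ‖ * y ≤ ‖f (V.proj φ) - F φ‖ * (K + y ^ 2 / K) :=
          mul_le_mul_of_nonneg_left hyK (norm_nonneg _)
      _ = K * ‖f (V.proj φ) - F φ‖ + ‖f (V.proj φ) - F φ‖ * y ^ 2 / K := by ring
      _ ≤ _ := by
          gcongr
          exact norm_sub_le _ _
  refine hle.trans_lt ?_
  rw [integral_add hi1 hi2, integral_const_mul, integral_div, integral_add h3.1 (hF _)]
  have h5 : K * ∫ φ, ‖f (V.proj φ) - F φ‖ ∂ν < ε / 2 := by
    rw [lt_div_iff₀ hK0] at h4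
    linarith
  have h6 : (∫ φ, ‖f (V.proj φ)‖ * Real.exp (RCLike.re (φ (a + a))) ∂ν +
      ∫ φ, ‖F φ‖ * Real.exp (RCLike.re (φ (a + a))) ∂ν) / K ≤ |D| / K := by
    refine div_le_div_of_nonneg_right ?_ hK0.le
    refine le_trans ?_ (le_abs_self D)
    rw [hD]
    linarith [h3.2]
  linarith

end ExpMoments

/-! ### The variances stay bounded along the directed set of subspaces. -/

section QuadExpMoments
variable {E : Type*} [NormedAddCommGroup E] [InnerProductSpace ℂ E]
  {B : E →ₗ[ℝ] E →ₗ[ℝ] ℂ}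

/-- A Gaussian whose variance is large has a small Fourier transform at each fixed t ≠ 0. The
transforms of the cylinder measures converge to the transform χ of ‖F‖ν, which near 0 stays close to
its mass m > 0; hence the variances cannot grow. The nonvanishing of ∫F enters only through m > 0.
-/
theorem hasExpMoments_quadExp (hsym : ∀ x y, B x y = B y x)
    (hcont : Continuous fun x => B x x) {F : AlgDual ℂ E → ℂ}
    (hF : IsL1Extension ℂ (1 / 2) (quadExp B) F)
    (h0 : ∫ φ, F φ ∂(gaussianMeasure ℂ E (1 / 2)) ≠ 0) : HasExpMoments ℂ (1 / 2) (quadExp B) := by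
  intro a
  set ν := gaussianMeasure ℂ E (1 / 2)
  set m : ℝ := ∫ φ, ‖F φ‖ ∂ν with hm
  have hm0 : 0 < m := (norm_pos_iff.2 h0).trans_le (norm_integral_le_integral_norm F)
  set χ : ℝ → ℂ := fun t => ∫ φ, (‖F φ‖ : ℂ) *
    Complex.exp (t * Complex.I * (RCLike.re (φ a) : ℝ)) ∂ν with hχ
  have hBm : ∀ t : ℝ, Measurable fun φ : AlgDual ℂ E =>
      Complex.exp (t * Complex.I * (RCLike.re (φ a) : ℝ)) := fun t =>
    ((Complex.measurable_ofReal.comp (measurable_re_eval a)).const_mul _).cexp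
  have hBn : ∀ (t : ℝ) (φ : AlgDual ℂ E),
      ‖Complex.exp (t * Complex.I * (RCLike.re (φ a) : ℝ))‖ = 1 := by
    intro t φ
    rw [mul_right_comm, ← Complex.ofReal_mul, Complex.norm_exp_ofReal_mul_I]
  have hχc : Continuous χ := by
    refine continuous_of_dominated (fun t => hF.1.norm.ofReal.aestronglyMeasurable.mul
      (hBm t).aestronglyMeasurable) (bound := fun φ => ‖F φ‖)
      (fun t => Eventually.of_forall fun φ => ?_) hF.1.norm (Eventually.of_forall fun φ => ?_)
    · rw [norm_mul, hBn, mul_one, Complex.norm_real, norm_norm]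
    · fun_prop
  have hχ0 : χ 0 = m := by
    rw [hm, ← integral_complex_ofReal]
    simp [hχ]
  obtain ⟨t, ht0, ht⟩ : ∃ t : ℝ, 0 < t ∧ m / 2 < ‖χ t‖ := by
    have h1 : ∀ᶠ t in 𝓝 (0 : ℝ), m / 2 < ‖χ t‖ := by
      refine (hχc.norm.tendsto 0).eventually_const_lt ?_
      rw [hχ0, Complex.norm_real, Real.norm_of_nonneg hm0.le]
      linarith
    exact ((h1.filter_mono nhdsWithin_le_nhds).and (self_mem_nhdsWithin (s := Set.Ioi 0))).exists.imp
      fun t h => ⟨h.2, h.1⟩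
  have l1 := (hF.norm.tendsto_integral_mul (hBm t) (fun φ => (hBn t φ).le)).norm.eventually_const_lt ht
  have l2 : ∀ᶠ V : FinSubspace ℂ E in atTop, ∫ φ, ‖quadExp B (V.proj φ)‖ ∂ν < 2 * m := by
    have h1 := (Complex.continuous_re.tendsto _).comp hF.norm.tendsto_integral
    simp only [Function.comp_def, integral_complex_ofReal, Complex.ofReal_re] at h1
    exact h1.eventually_lt_const (by linarith)
  -- Eventually the mass Z is below 2m and Z exp(−κt²/2) exceeds m/2. Hence exp(κt²/2) < 4, so κ/2 ≤
  -- log 4 / t², and the moment is Z exp(κ/2).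
  refine ⟨2 * m * Real.exp (Real.log 4 / t ^ 2), ?_⟩
  filter_upwards [hF.2.1, FinSubspace.eventually_mem ℂ a, l1, l2] with V hV ha h1 h2
  obtain ⟨κ, hi, hκ⟩ := exists_mgf_quadExp hsym hcont hV ha
  have hi1 := hi 1
  simp only [one_mul] at hi1
  refine ⟨hi1, ?_⟩
  set Z := ∫ φ, ‖quadExp B (V.proj φ)‖ ∂ν with hZ
  have hZ0 : 0 < Z := integral_norm_quadExp_pos hV
  have k1 := hκ 1
  have e1 : ∫ φ, ‖quadExp B (V.proj φ)‖ * Real.exp (RCLike.re (φ a)) ∂ν = Z * Real.exp (κ / 2) := by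
    apply Complex.ofReal_injective
    rw [← integral_complex_ofReal]
    push_cast
    simpa only [one_mul, one_pow, mul_one] using k1
  have e2 : m / 2 < Z * Real.exp (-(κ * t ^ 2 / 2)) := by
    rw [hκ, norm_mul, Complex.norm_real, Real.norm_of_nonneg hZ0.le, mul_pow, Complex.I_sq] at h1
    have : (κ : ℂ) * (t ^ 2 * -1) / 2 = ((-(κ * t ^ 2 / 2) : ℝ) : ℂ) := by
      push_cast
      ring
    rwa [this, Complex.norm_exp_ofReal] at h1
  have e3 : Real.exp (κ * t ^ 2 / 2) < 4 := by
    rw [Real.exp_neg, ← div_eq_mul_inv, lt_div_iff₀ (Real.exp_pos _)] at e2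
    nlinarith [Real.exp_pos (κ * t ^ 2 / 2)]
  have e4 : κ / 2 ≤ Real.log 4 / t ^ 2 := by
    have := (Real.lt_log_iff_exp_lt (by norm_num)).2 e3
    rw [le_div_iff₀ (by positivity)]
    linarith
  rw [e1]
  exact mul_le_mul h2.le (Real.exp_le_exp.2 e4) (Real.exp_pos _).le (by positivity)

end QuadExpMoments

/-! ### The gluing integral for an abstract conjugation and diagonal embedding. -/

section Model

/-- A conjugation `u` of `H`, an embedding `j` of `L` and a diagonal embedding `d` of `E`. -/
structure DiagonalModel (L E H : Type*) [NormedAddCommGroup L] [InnerProductSpace ℂ L]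
    [NormedAddCommGroup E] [InnerProductSpace ℂ E] [NormedAddCommGroup H]
    [InnerProductSpace ℂ H] where
  u : H →L[ℝ] H
  u_I : ∀ x, u (Complex.I • x) = -(Complex.I • u x)
  u_symm : ∀ x y, ⟪x, u y⟫_ℂ = ⟪y, u x⟫_ℂ
  d : E →L[ℝ] H
  j : L →ₗ[ℂ] H
  inner_j : ∀ α β, ⟪j α, j β⟫_ℂ = ⟪α, β⟫_ℂ
  inner_d_j : ∀ ξ α, ⟪d ξ, j α⟫_ℂ = 0
  inner_d_d : ∀ ξ σ, ⟪d ξ, d σ⟫_ℂ = 2 * ((⟪ξ, σ⟫_ℂ).re : ℝ)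
  exists_inner_d : ∀ y, ∃ a b : E, ∀ ξ,
    ⟪d ξ, y⟫_ℂ = (RCLike.re ⟪a, ξ⟫_ℂ : ℝ) + (RCLike.re ⟪b, ξ⟫_ℂ : ℝ) * Complex.I

variable {L E H : Type*} [NormedAddCommGroup L] [InnerProductSpace ℂ L]
    [NormedAddCommGroup E] [InnerProductSpace ℂ E] [NormedAddCommGroup H]
    [InnerProductSpace ℂ H] (D : DiagonalModel L E H)

namespace DiagonalModel

theorem u_smul (z : ℂ) (x : H) : D.u (z • x) = conj z • D.u x := by
  have h : ∀ (r : ℝ) (y : H), D.u ((r : ℂ) • y) = (r : ℂ) • D.u y := by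
    intro r y
    rw [Complex.coe_smul, Complex.coe_smul, map_smul]
  conv_lhs => rw [← Complex.re_add_im z, add_smul, mul_smul, map_add, h, h, D.u_I]
  conv_rhs => rw [← Complex.re_add_im z]
  rw [map_add, map_mul, Complex.conj_ofReal, Complex.conj_ofReal, Complex.conj_I, add_smul,
    mul_smul, neg_smul]

/-- The function `ξ ↦ ρ (K_(j τ + d ξ))` for the amplitude `ρ` of the real subspace fixed by `u`. -/
def kernel (τ : L) (ξ : E) : ℂ :=
  Complex.exp ((1 / 4) * ⟪D.j τ + D.d ξ, D.u (D.j τ + D.d ξ)⟫_ℂ)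

/-- The bilinear form `⟪d x, u (d y)⟫`. -/
def form : E →ₗ[ℝ] E →ₗ[ℝ] ℂ :=
  LinearMap.mk₂ ℝ (fun x y => ⟪D.d x, D.u (D.d y)⟫_ℂ)
    (fun x x' y => by simp only [map_add, inner_add_left])
    (fun r x y => by simp only [map_smul, inner_smul_left_eq_smul])
    (fun x y y' => by simp only [map_add, inner_add_right])
    (fun r x y => by simp only [map_smul, inner_smul_right_eq_smul])

theorem form_symm (x y : E) : D.form x y = D.form y x := D.u_symm _ _

theorem continuous_form : Continuous fun x => D.form x x :=
  D.d.continuous.inner (D.u.continuous.comp D.d.continuous)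

theorem kernel_zero : D.kernel 0 = quadExp D.form := by
  ext ξ
  simp only [kernel, map_zero, zero_add]
  rfl

theorem continuous_kernel (τ : L) : Continuous (D.kernel τ) := by
  have h : Continuous fun ξ => D.j τ + D.d ξ := continuous_const.add D.d.continuous
  exact (continuous_const.mul (h.inner (D.u.continuous.comp h))).cexp

theorem kernel_eq (τ : L) (ξ : E) : D.kernel τ ξ = Complex.exp ((1 / 4) * ⟪D.j τ, D.u (D.j τ)⟫_ℂ) *
    (quadExp D.form ξ * Complex.exp ((1 / 2) * ⟪D.d ξ, D.u (D.j τ)⟫_ℂ)) := by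
  rw [kernel, quadExp, ← Complex.exp_add, ← Complex.exp_add]
  congr 1
  have h : D.form ξ ξ = ⟪D.d ξ, D.u (D.d ξ)⟫_ℂ := rfl
  rw [h, map_add, inner_add_left, inner_add_right, inner_add_right, D.u_symm (D.j τ) (D.d ξ)]
  ring

/-- The element `α` extends by a diagonal element to a fixed vector of the conjugation. -/
def IsReal (α : L) : Prop := ∃ σ : E, D.u (D.j α + D.d σ) = D.j α + D.d σ

theorem IsReal.add_smul {α β : L} (hα : D.IsReal α) (hβ : D.IsReal β) (t : ℝ) :
    D.IsReal (α + (t : ℂ) • β) := by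
  obtain ⟨σ, hσ⟩ := hα
  obtain ⟨σ', hσ'⟩ := hβ
  have e : D.j (α + (t : ℂ) • β) + D.d (σ + t • σ') =
      D.j α + D.d σ + t • (D.j β + D.d σ') := by
    rw [map_add, map_add, map_smul, map_smul, smul_add, Complex.coe_smul]
    abel
  refine ⟨σ + t • σ', ?_⟩
  rw [e, map_add, map_smul, hσ, hσ']

/-- Put x = jα + dσ. As u fixes x, ⟪x + dξ, u(x + dξ)⟫ = ⟪x, x⟫ + 2⟪dξ, x⟫ + B(ξ, ξ), with ⟪dξ, x⟫ =
2 re⟪σ, ξ⟫ and ⟪x, x⟫ = ⟪α, α⟫ + 2‖σ‖². After division by 4 the terms in σ cancel the Cameron–Martin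
weight exactly; the diagonal doubling of the norm matches the amplitude measure for g/4 with the
gluing measure for g/2. -/
theorem kernel_shift {α : L} {σ : E} (h : D.u (D.j α + D.d σ) = D.j α + D.d σ) (ξ : E) :
    (Real.exp (-RCLike.re ⟪σ, ξ⟫_ℂ - ‖σ‖ ^ 2 / 2) : ℂ) * D.kernel α (ξ + σ) =
      Complex.exp ((1 / 4) * ⟪α, α⟫_ℂ) * quadExp D.form ξ := by
  set x := D.j α + D.d σ with hx
  have e : D.j α + D.d (ξ + σ) = x + D.d ξ := by
    rw [hx, map_add]
    abel
  have hf : D.form ξ ξ = ⟪D.d ξ, D.u (D.d ξ)⟫_ℂ := rfl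
  have h1 : ⟪D.d ξ, x⟫_ℂ = 2 * ((⟪σ, ξ⟫_ℂ).re : ℝ) := by
    rw [hx, inner_add_right, D.inner_d_j, D.inner_d_d, zero_add, ← inner_conj_symm σ ξ,
      Complex.conj_re]
  have hj : ⟪D.j α, D.d σ⟫_ℂ = 0 := by
    rw [← inner_conj_symm, D.inner_d_j, map_zero]
  have hn : ((⟪σ, σ⟫_ℂ).re : ℝ) = ‖σ‖ ^ 2 := by
    rw [inner_self_eq_norm_sq_to_K]
    norm_cast
  have h2 : ⟪x, x⟫_ℂ = ⟪α, α⟫_ℂ + 2 * (‖σ‖ ^ 2 : ℝ) := by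
    rw [hx, inner_add_left, inner_add_right, inner_add_right, D.inner_j, D.inner_d_j, D.inner_d_d,
      hj, hn]
    ring
  clear_value x
  rw [kernel, quadExp, Complex.ofReal_exp, ← Complex.exp_add, ← Complex.exp_add, e, map_add, h,
    inner_add_left, inner_add_right, inner_add_right, D.u_symm x, h, h1, h2, hf]
  congr 1
  rw [RCLike.re_eq_complex_re]
  push_cast
  ring

variable {F : AlgDual ℂ E → ℂ}

theorem isL1Extension_kernel (hF : IsL1Extension ℂ (1 / 2) (D.kernel 0) F)
    (h0 : ∫ φ, F φ ∂(gaussianMeasure ℂ E (1 / 2)) ≠ 0) {τ : L} {a b : E}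
    (hab : ∀ ξ, (1 / 2) * ⟪D.d ξ, D.u (D.j τ)⟫_ℂ =
      (RCLike.re ⟪a, ξ⟫_ℂ : ℝ) + (RCLike.re ⟪b, ξ⟫_ℂ : ℝ) * Complex.I) :
    IsL1Extension ℂ (1 / 2) (D.kernel τ) fun φ =>
      Complex.exp ((1 / 4) * ⟪D.j τ, D.u (D.j τ)⟫_ℂ) *
        (F φ * Complex.exp ((RCLike.re (φ a) : ℝ) + (RCLike.re (φ b) : ℝ) * Complex.I)) := by
  rw [kernel_zero] at hF
  have h := ((hasExpMoments_quadExp D.form_symm D.continuous_form hF h0).isL1Extension_mul_exp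
    hF a b).const_mul (Complex.exp ((1 / 4) * ⟪D.j τ, D.u (D.j τ)⟫_ℂ))
  simp only [← hab, ← kernel_eq] at h
  exact h

theorem exists_half_inner_d (y : H) : ∃ a b : E, ∀ ξ, (1 / 2) * ⟪D.d ξ, y⟫_ℂ =
      (RCLike.re ⟪a, ξ⟫_ℂ : ℝ) + (RCLike.re ⟪b, ξ⟫_ℂ : ℝ) * Complex.I := by
  obtain ⟨a, b, h⟩ := D.exists_inner_d ((1 / 2 : ℂ) • y)
  exact ⟨a, b, fun ξ => by rw [← h, inner_smul_right]⟩

theorem gaussIntegrable_kernel (hF : IsL1Extension ℂ (1 / 2) (D.kernel 0) F)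
    (h0 : ∫ φ, F φ ∂(gaussianMeasure ℂ E (1 / 2)) ≠ 0) (τ : L) :
    GaussIntegrable ℂ (1 / 2) (D.kernel τ) := by
  obtain ⟨a, b, hab⟩ := D.exists_half_inner_d (D.u (D.j τ))
  exact ⟨_, D.isL1Extension_kernel hF h0 hab⟩

/-- For every V containing σ the cylinder integrals satisfy the identity exactly, by translation; it
then passes to the limit. -/
theorem gaussIntegral_kernel_of_isReal (hF : IsL1Extension ℂ (1 / 2) (D.kernel 0) F)
    (h0 : ∫ φ, F φ ∂(gaussianMeasure ℂ E (1 / 2)) ≠ 0) {α : L} (hα : D.IsReal α) :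
    gaussIntegral ℂ (1 / 2) (D.kernel α) =
      Complex.exp ((1 / 4) * ⟪α, α⟫_ℂ) * ∫ φ, F φ ∂(gaussianMeasure ℂ E (1 / 2)) := by
  obtain ⟨F', hF'⟩ := D.gaussIntegrable_kernel hF h0 α
  rw [hF'.gaussIntegral_eq]
  obtain ⟨σ, hσ⟩ := hα
  refine tendsto_nhds_unique hF'.tendsto_integral ?_
  refine (hF.tendsto_integral.const_mul (Complex.exp ((1 / 4) * ⟪α, α⟫_ℂ))).congr' ?_
  filter_upwards [FinSubspace.eventually_mem ℂ σ] with V hV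
  rw [← (V.cameronMartin hV (D.continuous_kernel α)).2, ← integral_const_mul]
  refine integral_congr_ae (Eventually.of_forall fun φ => ?_)
  simp only
  rw [kernel_zero, ← V.inner_proj φ hV, D.kernel_shift hσ]

/-- No real translation is available for α + iβ. Instead, both sides are continued analytically from
the vectors α + tβ with t real, where the preceding case applies. The exponential moments make the
integral entire in the parameter. -/
theorem gaussIntegral_kernel (hF : IsL1Extension ℂ (1 / 2) (D.kernel 0) F)
    (h0 : ∫ φ, F φ ∂(gaussianMeasure ℂ E (1 / 2)) ≠ 0) {α β : L} (hα : D.IsReal α)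
    (hβ : D.IsReal β) :
    gaussIntegral ℂ (1 / 2) (D.kernel (α + Complex.I • β)) =
      Complex.exp ((1 / 4) * ⟪α + Complex.I • β, α - Complex.I • β⟫_ℂ) *
        ∫ φ, F φ ∂(gaussianMeasure ℂ E (1 / 2)) := by
  set ν := gaussianMeasure ℂ E (1 / 2)
  have hF' := hF
  rw [kernel_zero] at hF'
  have hmom := (hasExpMoments_quadExp D.form_symm D.continuous_form hF' h0).integrable_norm_mul_exp hF'
  obtain ⟨a, b, hab⟩ := D.exists_half_inner_d (D.u (D.j α))
  obtain ⟨a', b', hab'⟩ := D.exists_half_inner_d (D.u (D.j β))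
  let e : AlgDual ℂ E → ℂ := fun φ =>
    Complex.exp ((RCLike.re (φ a) : ℝ) + (RCLike.re (φ b) : ℝ) * Complex.I)
  have hre : ∀ (φ : AlgDual ℂ E) (t : ℝ) (x : E), RCLike.re (φ (t • x)) = t * RCLike.re (φ x) := by
    intro φ t x
    rw [← Complex.coe_smul, LinearMap.map_smulₛₗ, Complex.conj_ofReal, smul_eq_mul,
      RCLike.re_eq_complex_re, Complex.re_ofReal_mul]
  have hrei : ∀ (t : ℝ) (x ξ : E), RCLike.re ⟪t • x, ξ⟫_ℂ = t * RCLike.re ⟪x, ξ⟫_ℂ := by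
    intro t x ξ
    rw [inner_smul_left_eq_smul, Complex.real_smul, RCLike.re_eq_complex_re, Complex.re_ofReal_mul]
  -- The parameter enters as conj w because u and the first slot of the inner product are
  -- antilinear; the exponent is then a polynomial in w.
  have hu : ∀ w : ℂ, D.u (D.j (α + conj w • β)) = D.u (D.j α) + w • D.u (D.j β) := by
    intro w
    rw [map_add, map_add, map_smul, D.u_smul, Complex.conj_conj]
  set P : ℂ → ℂ := fun w => ⟪D.j α, D.u (D.j α)⟫_ℂ + w * ⟪D.j α, D.u (D.j β)⟫_ℂ +
    (w * ⟪D.j β, D.u (D.j α)⟫_ℂ + w * (w * ⟪D.j β, D.u (D.j β)⟫_ℂ)) with hP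
  have h1 : ∀ w : ℂ, gaussIntegral ℂ (1 / 2) (D.kernel (α + conj w • β)) =
      Complex.exp ((1 / 4) * P w) * ∫ φ, F φ * e φ * Complex.exp (w *
        ((RCLike.re (φ a') : ℝ) + (RCLike.re (φ b') : ℝ) * Complex.I)) ∂ν := by
    intro w
    -- These vectors separate the real and imaginary parts of the product of w with the linear form
    -- re⟪a', ξ⟫ + i re⟪b', ξ⟫.
    have h := D.isL1Extension_kernel hF h0 (τ := α + conj w • β)
      (a := a + (w.re • a' + (-w.im) • b')) (b := b + (w.im • a' + w.re • b')) ?_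
    · rw [h.gaussIntegral_eq, integral_const_mul, hu, map_add, map_smul, inner_add_left,
        inner_add_right, inner_add_right, inner_smul_left, inner_smul_left, inner_smul_right,
        inner_smul_right, Complex.conj_conj]
      congr 1
      refine integral_congr_ae (Eventually.of_forall fun φ => ?_)
      simp only [e]
      rw [mul_assoc, ← Complex.exp_add]
      congr 2
      simp only [map_add, hre]
      conv_rhs => rw [← Complex.re_add_im w]
      push_cast
      linear_combination (-(w.im : ℂ) * (RCLike.re (φ b') : ℝ)) * Complex.I_sq
    · intro ξ
      rw [hu, inner_add_right, mul_add, hab, inner_smul_right, mul_left_comm, hab']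
      simp only [inner_add_left, map_add, hrei]
      conv_lhs => rw [← Complex.re_add_im w]
      push_cast
      linear_combination ((w.im : ℂ) * (RCLike.re ⟪b', ξ⟫_ℂ : ℝ)) * Complex.I_sq
  have hem : Measurable e := by
    have h2 := measurable_re_eval (𝕜 := ℂ) a
    have h3 := measurable_re_eval (𝕜 := ℂ) b
    exact ((Complex.measurable_ofReal.comp h2).add
      ((Complex.measurable_ofReal.comp h3).mul_const _)).cexp
  have hd : Differentiable ℂ fun w : ℂ => ∫ φ, F φ * e φ * Complex.exp (w *
        ((RCLike.re (φ a') : ℝ) + (RCLike.re (φ b') : ℝ) * Complex.I)) ∂ν := by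
    refine differentiable_integral_exp (hF.1.aestronglyMeasurable.mul hem.aestronglyMeasurable)
      (measurable_re_eval a') (measurable_re_eval b') fun s t => ?_
    refine (hmom (a + (s • a' + t • b'))).congr (Eventually.of_forall fun φ => ?_)
    simp only
    rw [norm_mul, Complex.norm_exp, mul_assoc, ← Real.exp_add]
    simp only [map_add, hre]
    simp
  -- The value w = −i is taken because its conjugate is i.
  have h2 := congrFun (eq_of_eq_on_reals (f := fun w => Complex.exp ((1 / 4) * P w) *
      ∫ φ, F φ * e φ * Complex.exp (w *
        ((RCLike.re (φ a') : ℝ) + (RCLike.re (φ b') : ℝ) * Complex.I)) ∂ν)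
    (g := fun w => Complex.exp ((1 / 4) * (⟪α, α⟫_ℂ + w * ⟪α, β⟫_ℂ +
      (w * ⟪β, α⟫_ℂ + w * (w * ⟪β, β⟫_ℂ)))) * ∫ φ, F φ ∂ν) ?_ (by fun_prop) ?_) (-Complex.I)
  · simp only [← h1] at h2
    rw [map_neg, Complex.conj_I, neg_neg] at h2
    rw [h2, inner_add_left, inner_sub_right, inner_sub_right, inner_smul_left, inner_smul_left,
      inner_smul_right, inner_smul_right, Complex.conj_I]
    congr 2
    ring
  · refine Differentiable.mul ?_ hd
    simp only [hP]
    fun_prop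
  · intro t
    rw [← h1, Complex.conj_ofReal, D.gaussIntegral_kernel_of_isReal hF h0 (hα.add_smul D hβ t),
      inner_add_left, inner_add_right, inner_add_right, inner_smul_left, inner_smul_left,
      inner_smul_right, inner_smul_right, Complex.conj_ofReal]

end DiagonalModel
end Model

/-! ### The boundary of the gluing as a diagonal model, and the gluing identity. -/

section GluingTheorem
variable {L₁ LS X X₁ : Type*} [NormedAddCommGroup L₁] [InnerProductSpace ℂ L₁]
  [NormedAddCommGroup LS] [InnerProductSpace ℂ LS]
  [AddCommGroup X] [Module ℝ X] [AddCommGroup X₁] [Module ℝ X₁]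

theorem Region.amplitude_eq_of_conjugation {L : Type*} [NormedAddCommGroup L]
    [InnerProductSpace ℂ L] (M : Region L X) {u : L → L}
    (hu : ∀ x, ∃ a ∈ M.solutions, ∃ b ∈ M.solutions,
        x = a + Complex.I • b ∧ u x = a - Complex.I • b) (ξ : L) :
    M.Integrable (coherentState ξ) ∧
      M.amplitude (coherentState ξ) = Complex.exp ((1 / 4) * ⟪ξ, u ξ⟫_ℂ) := by
  obtain ⟨a, ha, b, hb, hx, hux⟩ := hu ξ
  rw [hux, hx]
  exact M.amplitude_coherentState ha hb

theorem Region.integrable_add {L : Type*} [NormedAddCommGroup L] [InnerProductSpace ℂ L]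
    {M : Region L X} {ψ ψ' : L → ℂ} (h : M.Integrable ψ) (h' : M.Integrable ψ') :
    M.Integrable (ψ + ψ') ∧ M.amplitude (ψ + ψ') = M.amplitude ψ + M.amplitude ψ' := by
  let _ := realInnerProductSpace M.solutions
  obtain ⟨F, hF⟩ := h
  obtain ⟨F', hF'⟩ := h'
  exact ⟨⟨_, hF.add hF'⟩, gaussIntegral_add ⟨F, hF⟩ ⟨F', hF'⟩⟩

theorem Region.integrable_const_smul {L : Type*} [NormedAddCommGroup L] [InnerProductSpace ℂ L]
    {M : Region L X} (a : ℂ) {ψ : L → ℂ} (h : M.Integrable ψ) :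
    M.Integrable (a • ψ) ∧ M.amplitude (a • ψ) = a * M.amplitude ψ := by
  let _ := realInnerProductSpace M.solutions
  obtain ⟨F, hF⟩ := h
  exact ⟨⟨_, hF.const_mul a⟩, gaussIntegral_const_mul a ⟨F, hF⟩⟩

variable (LS) in
/-- The inclusion of the first summand into the solutions on the boundary. -/
def boundaryFst (τ : L₁) : Boundary L₁ LS := WithLp.toLp 2 (τ, WithLp.toLp 2 (0, 0))

variable (L₁) in
/-- The diagonal inclusion of the solutions that agree on both copies of the gluing surface. -/
def boundaryDiag (ξ : LS) : Boundary L₁ LS := WithLp.toLp 2 (0, WithLp.toLp 2 (ξ, toConj LS ξ))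

theorem inner_boundary (x y : Boundary L₁ LS) :
    ⟪x, y⟫_ℂ = ⟪x.fst, y.fst⟫_ℂ + (⟪x.snd.fst, y.snd.fst⟫_ℂ +
      ⟪ofConj LS y.snd.snd, ofConj LS x.snd.snd⟫_ℂ) := by
  rw [WithLp.prod_inner_apply, WithLp.prod_inner_apply]
  rfl

theorem inner_boundaryDiag (ξ : LS) (y : Boundary L₁ LS) :
    ⟪boundaryDiag L₁ ξ, y⟫_ℂ = ⟪ξ, y.snd.fst⟫_ℂ + ⟪ofConj LS y.snd.snd, ξ⟫_ℂ := by
  rw [inner_boundary]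
  change ⟪(0 : L₁), _⟫_ℂ + _ = _
  rw [inner_zero_left, zero_add]
  rfl

theorem inner_boundaryFst (τ : L₁) (y : Boundary L₁ LS) :
    ⟪boundaryFst LS τ, y⟫_ℂ = ⟪τ, y.fst⟫_ℂ := by
  rw [inner_boundary]
  change _ + (⟪(0 : LS), _⟫_ℂ + ⟪_, (0 : LS)⟫_ℂ) = _
  rw [inner_zero_left, inner_zero_right, add_zero, add_zero]
  rfl

/-- The conjugate of K_ξ is the coherent state of ξ on the conjugate space, and a product of
coherent states on an orthogonal sum is the coherent state of the sum. -/
theorem tensor₃_coherentState (τ : L₁) (ξ : LS) :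
    tensor₃ (coherentState τ) (coherentState ξ) (iota (coherentState ξ)) =
      coherentState (boundaryFst LS τ + boundaryDiag L₁ ξ) := by
  ext φ
  simp only [tensor₃, coherentState, iota]
  rw [inner_add_left, inner_boundaryFst, inner_boundaryDiag, ← Complex.exp_conj, ← Complex.exp_add,
    ← Complex.exp_add, map_mul, inner_conj_symm]
  congr 1
  have : conj (1 / 2 : ℂ) = 1 / 2 := by
    simpa using Complex.conj_ofReal (1 / 2)
  rw [this]
  ring

/-- The boundary solutions of a gluing, with a conjugation. -/
def boundaryModel (u : Boundary L₁ LS →L[ℝ] Boundary L₁ LS)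
    (hI : ∀ x, u (Complex.I • x) = -(Complex.I • u x))
    (hs : ∀ x y, ⟪x, u y⟫_ℂ = ⟪y, u x⟫_ℂ) : DiagonalModel L₁ LS (Boundary L₁ LS) where
  u := u
  u_I := hI
  u_symm := hs
  d :=
    { toFun := boundaryDiag L₁
      map_add' := fun x y => by
        simp only [boundaryDiag, ← WithLp.toLp_add, Prod.mk_add_mk, add_zero]
        rfl
      map_smul' := fun r x => by
        have h : toConj LS (r • x) = (r : ℂ) • toConj LS x := by
          change r • x = conj (r : ℂ) • x
          rw [Complex.conj_ofReal, Complex.coe_smul]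
        change _ = (r : ℂ) • boundaryDiag L₁ x
        simp only [boundaryDiag, ← WithLp.toLp_smul, Prod.smul_mk, smul_zero, h, Complex.coe_smul]
      cont := by
        have h : Continuous (toConj LS) := continuous_id
        unfold boundaryDiag
        fun_prop }
  j :=
    { toFun := boundaryFst LS
      map_add' := fun x y => by
        simp only [boundaryFst, ← WithLp.toLp_add, Prod.mk_add_mk, add_zero]
      map_smul' := fun r x => by
        simp only [boundaryFst, ← WithLp.toLp_smul, Prod.smul_mk, smul_zero, RingHom.id_apply] }
  inner_j := fun α β => inner_boundaryFst α _
  inner_d_j := fun ξ α => by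
    change ⟪boundaryDiag L₁ ξ, boundaryFst LS α⟫_ℂ = 0
    rw [inner_boundaryDiag]
    change ⟪ξ, (0 : LS)⟫_ℂ + ⟪(0 : LS), ξ⟫_ℂ = 0
    rw [inner_zero_left, inner_zero_right, add_zero]
  inner_d_d := fun ξ σ => by
    change ⟪boundaryDiag L₁ ξ, boundaryDiag L₁ σ⟫_ℂ = _
    rw [inner_boundaryDiag]
    change ⟪ξ, σ⟫_ℂ + ⟪σ, ξ⟫_ℂ = _
    rw [← inner_conj_symm σ ξ, Complex.add_conj]
    push_cast
    rfl
  exists_inner_d := fun y => by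
    -- Let p and q be the two components of y on the gluing surface. Then ⟪dξ, y⟫ = ⟪ξ, p⟫ + ⟪q, ξ⟫
    -- has real part re⟪p + q, ξ⟫ and imaginary part im⟪q − p, ξ⟫ = re⟪i(q − p), ξ⟫.
    refine ⟨y.snd.fst + ofConj LS y.snd.snd,
      Complex.I • (ofConj LS y.snd.snd - y.snd.fst), fun ξ => ?_⟩
    change ⟪boundaryDiag L₁ ξ, y⟫_ℂ = _
    rw [inner_boundaryDiag, ← inner_conj_symm ξ, inner_smul_left, inner_add_left, inner_sub_left]
    refine Complex.ext ?_ ?_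
    · simpa using inner_re_symm (𝕜 := ℂ) ξ y.snd.fst
    · simp only [Complex.add_im, Complex.conj_im, Complex.conj_I, RCLike.re_eq_complex_re]
      simp
      ring

variable (G : GluingData L₁ LS X X₁)

theorem GluingData.exists_model [CompleteSpace L₁] [CompleteSpace LS] :
    ∃ D : DiagonalModel L₁ LS (Boundary L₁ LS),
      (∀ τ, G.integrand (coherentState τ) = D.kernel τ) ∧
      (∀ ξ, G.M.Integrable (coherentState ξ)) ∧ ∀ α ∈ G.M₁.solutions, D.IsReal α := by
  obtain ⟨u, huM, hI, hs, hu⟩ := G.M.exists_conjugation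
  refine ⟨boundaryModel u hI hs, fun τ => funext fun ξ => ?_,
    fun ξ => (G.M.amplitude_eq_of_conjugation hu ξ).1, ?_⟩
  · rw [GluingData.integrand, tensor₃_coherentState, (G.M.amplitude_eq_of_conjugation hu _).2]
    rfl
  · rintro α ⟨x, rfl⟩
    -- A glued solution has equal components on both copies of the surface. Their common value is
    -- the required diagonal element, and the sum is a solution of `M`, fixed by u.
    refine ⟨(G.M.r (G.glue x)).snd.fst, ?_⟩
    have h : boundaryFst LS (G.M₁.r x) + boundaryDiag L₁ (G.M.r (G.glue x)).snd.fst =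
        G.M.r (G.glue x) := by
      have h1 := (G.range_glue (G.glue x)).1 ⟨x, rfl⟩
      have h2 : toConj LS (G.M.r (G.glue x)).snd.fst = (G.M.r (G.glue x)).snd.snd := h1
      simp only [boundaryFst, boundaryDiag, ← WithLp.toLp_add, Prod.mk_add_mk, add_zero, zero_add,
        h2, ← G.r_glue]
      rfl
    change u (boundaryFst LS (G.M₁.r x) + boundaryDiag L₁ (G.M.r (G.glue x)).snd.fst) =
      boundaryFst LS (G.M₁.r x) + boundaryDiag L₁ (G.M.r (G.glue x)).snd.fst
    rw [h]
    exact huM _ ⟨_, rfl⟩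

/-- The assertion of the gluing axiom for the state `ψ`, with cylinder states on the boundary. -/
def GluingData.GlueState (c : ℂ) (ψ : L₁ → ℂ) : Prop :=
  (∀ ξ : LS, (∃ V, IsCylinderState V (tensor₃ ψ (coherentState ξ) (iota (coherentState ξ)))) ∧
    tensor₃ ψ (coherentState ξ) (iota (coherentState ξ)) ∈ coherentSpan (Boundary L₁ LS) ∧
    G.M.Integrable (tensor₃ ψ (coherentState ξ) (iota (coherentState ξ)))) ∧
  GaussIntegrable ℂ (1 / 2) (G.integrand ψ) ∧ G.M₁.Integrable ψ ∧
  G.M₁.amplitude ψ * c = G.integral ψ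

variable {G} {c : ℂ}

/-- Integrals default to 0 on functions that are not integrable, so additivity requires the
integrability statements carried along in `GlueState`. -/
theorem GluingData.GlueState.add {ψ ψ' : L₁ → ℂ} (h : G.GlueState c ψ) (h' : G.GlueState c ψ') :
    G.GlueState c (ψ + ψ') := by
  obtain ⟨h1, h2, h3, h4⟩ := h
  obtain ⟨h1', h2', h3', h4'⟩ := h'
  have ht : ∀ ξ : LS, tensor₃ (ψ + ψ') (coherentState ξ) (iota (coherentState ξ)) =
      tensor₃ ψ (coherentState ξ) (iota (coherentState ξ)) +
        tensor₃ ψ' (coherentState ξ) (iota (coherentState ξ)) := by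
    intro ξ
    ext φ
    simp only [tensor₃, Pi.add_apply]
    ring
  have hint : G.integrand (ψ + ψ') = fun ξ => G.integrand ψ ξ + G.integrand ψ' ξ := by
    ext ξ
    rw [GluingData.integrand, ht]
    exact (Region.integrable_add (h1 ξ).2.2 (h1' ξ).2.2).2
  obtain ⟨hi, hamp⟩ := Region.integrable_add h3 h3'
  refine ⟨fun ξ => ?_, ?_, hi, ?_⟩
  · obtain ⟨V, hV⟩ := (h1 ξ).1
    obtain ⟨W, hW⟩ := (h1' ξ).1
    rw [ht]
    exact ⟨hV.add hW, Submodule.add_mem _ (h1 ξ).2.1 (h1' ξ).2.1,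
      (Region.integrable_add (h1 ξ).2.2 (h1' ξ).2.2).1⟩
  · obtain ⟨F, hF⟩ := h2
    obtain ⟨F', hF'⟩ := h2'
    rw [hint]
    exact ⟨_, hF.add hF'⟩
  · rw [hamp, add_mul, h4, h4', GluingData.integral, GluingData.integral, GluingData.integral, hint,
      gaussIntegral_add h2 h2']

theorem GluingData.GlueState.const_smul (a : ℂ) {ψ : L₁ → ℂ} (h : G.GlueState c ψ) :
    G.GlueState c (a • ψ) := by
  obtain ⟨h1, h2, h3, h4⟩ := h
  have ht : ∀ ξ : LS, tensor₃ (a • ψ) (coherentState ξ) (iota (coherentState ξ)) =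
      a • tensor₃ ψ (coherentState ξ) (iota (coherentState ξ)) := by
    intro ξ
    ext φ
    simp only [tensor₃, Pi.smul_apply, smul_eq_mul]
    ring
  have hint : G.integrand (a • ψ) = fun ξ => a * G.integrand ψ ξ := by
    ext ξ
    rw [GluingData.integrand, ht]
    exact (Region.integrable_const_smul a (h1 ξ).2.2).2
  obtain ⟨hi, hamp⟩ := Region.integrable_const_smul a h3
  refine ⟨fun ξ => ?_, ?_, hi, ?_⟩
  · obtain ⟨V, hV⟩ := (h1 ξ).1
    rw [ht]
    exact ⟨⟨V, hV.const_smul a⟩, Submodule.smul_mem _ a (h1 ξ).2.1,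
      (Region.integrable_const_smul a (h1 ξ).2.2).1⟩
  · obtain ⟨F, hF⟩ := h2
    rw [hint]
    exact ⟨_, hF.const_mul a⟩
  · rw [hamp, mul_assoc, h4, GluingData.integral, GluingData.integral, hint,
      gaussIntegral_const_mul a h2]

/-- Writing τ = α + iβ with α, β in the Lagrangian subspace of `M₁`, the amplitude of K_τ and the
gluing integral contain the same factor exp(¼⟪α + iβ, α − iβ⟫). -/
theorem GluingData.glueState_coherentState [CompleteSpace L₁] [CompleteSpace LS]
    (hG : G.IntegrabilityCondition) (τ : L₁) :
    G.GlueState (G.integral (coherentState 0)) (coherentState τ) := by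
  obtain ⟨D, hD, hM, hreal⟩ := G.exists_model
  obtain ⟨⟨F, hF⟩, h0⟩ := hG
  rw [GluingData.integral, hF.gaussIntegral_eq] at h0
  have hF0 := hF
  rw [hD] at hF
  obtain ⟨u₁, -, -, -, hu₁⟩ := G.M₁.exists_conjugation
  obtain ⟨α, hα, β, hβ, rfl, -⟩ := hu₁ τ
  refine ⟨fun ξ => ?_, ?_, (G.M₁.amplitude_coherentState hα hβ).1, ?_⟩
  · rw [tensor₃_coherentState]
    exact ⟨isCylinderState_coherentState _, Submodule.subset_span ⟨_, rfl⟩, hM _⟩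
  · rw [hD]
    exact D.gaussIntegrable_kernel hF h0 _
  · rw [(G.M₁.amplitude_coherentState hα hβ).2, GluingData.integral, hF0.gaussIntegral_eq,
      GluingData.integral, hD, D.gaussIntegral_kernel hF h0 (hreal α hα) (hreal β hβ)]

theorem GluingData.glueState_of_mem_coherentSpan [CompleteSpace L₁] [CompleteSpace LS]
    (hG : G.IntegrabilityCondition) {ψ : L₁ → ℂ} (hψ : ψ ∈ coherentSpan L₁) :
    G.GlueState (G.integral (coherentState 0)) ψ := by
  refine Submodule.span_induction (p := fun ψ _ => G.GlueState (G.integral (coherentState 0)) ψ)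
    ?_ ?_ (fun _ _ _ _ h h' => h.add h') (fun a _ _ h => h.const_smul a) hψ
  · rintro _ ⟨τ, rfl⟩
    exact glueState_coherentState hG τ
  -- The zero state is treated as 0 · K_0.
  · simpa using (glueState_coherentState hG (0 : L₁)).const_smul 0

/-- K_0 is the constant 1, so its amplitude is the mass of a probability measure. This normalization
determines the anomaly factor. -/
theorem Region.amplitude_coherentState_zero {L : Type*} [NormedAddCommGroup L]
    [InnerProductSpace ℂ L] (M : Region L X) :
    coherentState 0 ∈ M.domain ∧ M.amplitude (coherentState 0) = 1 := by
  have h := M.amplitude_coherentState M.solutions.zero_mem M.solutions.zero_mem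
  rw [smul_zero, add_zero, sub_zero, inner_zero_left, mul_zero, Complex.exp_zero] at h
  obtain ⟨V, hV⟩ := isCylinderState_coherentState (0 : L)
  exact ⟨⟨hV.mem_stateSpace, Submodule.subset_span ⟨0, rfl⟩, h.1⟩, h.2⟩

end GluingTheorem

end HoloQuant
end

theorem mainTheorem1
    {L₁ LS X X₁ : Type*}
    [NormedAddCommGroup L₁] [InnerProductSpace ℂ L₁] [CompleteSpace L₁]
    [TopologicalSpace.SeparableSpace L₁]
    [NormedAddCommGroup LS] [InnerProductSpace ℂ LS] [CompleteSpace LS]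
    [TopologicalSpace.SeparableSpace LS]
    [AddCommGroup X] [Module ℝ X] [AddCommGroup X₁] [Module ℝ X₁]
    (G : HoloQuant.GluingData L₁ LS X X₁) (hG : G.IntegrabilityCondition) :
    (∃ c : ℂ, G.GluingAxiom c) ∧
      ∀ c : ℂ, G.GluingAxiom c →
        c = HoloQuant.gaussIntegral ℂ (1 / 2) (fun ξ : LS =>
          G.M.amplitude (HoloQuant.tensor₃ (HoloQuant.coherentState 0)
            (HoloQuant.coherentState ξ) (HoloQuant.iota (HoloQuant.coherentState ξ)))) := by
  refine ⟨⟨G.integral (HoloQuant.coherentState 0), hG.2, fun ψ hψ => ?_⟩, fun c hc => ?_⟩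
  · obtain ⟨h1, h2, -, h4⟩ := HoloQuant.GluingData.glueState_of_mem_coherentSpan hG hψ.2.1
    refine ⟨fun ξ => ?_, h2, h4⟩
    obtain ⟨⟨V, hV⟩, hspan, hint⟩ := h1 ξ
    exact ⟨hV.mem_stateSpace, hspan, hint⟩
  · have h := G.M₁.amplitude_coherentState_zero
    have h' := (hc.2 _ h.1).2.2
    rw [h.2, one_mul] at h'
    exact h'
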